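/- Consider the one-dimensional Klein-Gordon-Zakharov system for real-valued functions $u,n,v$ on $[0,\infty)\times\mathbb{R}$, \[ u_{tt}-u_{xx}+u=-nu,\qquad n_t+v_x=0,\qquad v_t+\left(n+|u|^2\right)_x=0 . \] There exists an absolute constant $\varepsilon>0$ such that the following holds. Let $(u,u_t,n,v)\in C\left([0,\infty),\,H^1(\mathbb{R})\times L^2(\mathbb{R})\times L^2(\mathbb{R})\times L^2(\mathbb{R})\right)$ be a solution of this system, in the sense of distributions, such that $u(t,\cdot)$ is odd for every $t\ge 0$ and \[ \sup_{t\ge 0}\|u(t)\|_{H^1(\mathbb{R})}\le\varepsilon\qquad\text{and}\qquad \sup_{t\ge 0}\|u_t(t)\|_{L^2(\mathbb{R})}\le C \] for some constant $C>0$. Then, for every compact interval $I\subset\mathbb{R}$, \[ \lim_{t\to\infty}\left(\|u(t)\|_{H^1(I)}+\|u_t(t)\|_{L^2(I)}+\|n(t)\|_{L^2(I)}+\|v(t)\|_{L^2(I)}\right)=0 . \] (The energy $\int_{\mathbb{R}} |u|^2+|u_x|^2+|u_t|^2+\tfrac12\left(|n|^2+|v|^2\right)+n|u|^2\,dx$ is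 automatically finite at every time for such functions.) -/

import Mathlib

open MeasureTheory Set Filter Topology
open scoped ContDiff

noncomputable section

/-- The real Hilbert space `L²(ℝ)` of real-valued functions. -/
abbrev L2R : Type := Lp ℝ 2 (volume : Measure ℝ)

/-- Test functions on `ℝ`: smooth with compact support. -/
structure IsTestFunction (ψ : ℝ → ℝ) : Prop where
  smooth : ContDiff ℝ ∞ ψ
  compactSupport : HasCompactSupport ψ

/-- `g` is the weak (distributional) derivative of `f` on `ℝ`. -/
def HasWeakDeriv (f g : L2R) : Prop :=
  ∀ ψ : ℝ → ℝ, IsTestFunction ψ → ∫ x, f x * deriv ψ x = - ∫ x, g x * ψ x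

theorem IsTestFunction.deriv {ψ : ℝ → ℝ} (h : IsTestFunction ψ) : IsTestFunction (deriv ψ) :=
  ⟨((contDiff_infty_iff_deriv (𝕜 := ℝ)).1 h.smooth).2, h.compactSupport.deriv⟩

theorem IsTestFunction.integrable_mul {ψ : ℝ → ℝ} (h : IsTestFunction ψ) (f : L2R) :
    Integrable (fun x => f x * ψ x) :=
  (Lp.memLp f).integrable_mul (q := 2)
    (h.smooth.continuous.memLp_of_hasCompactSupport h.compactSupport)

/-- The Sobolev space `H¹(ℝ)`: pairs `(f, f_x)` of `L²` functions, the second one being the weak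
derivative of the first one (so that it is determined by it), with the norm
`(‖f‖² + ‖f_x‖²)^(1/2)` inherited from the Hilbert sum of two copies of `L²(ℝ)`. -/
def H1R : Submodule ℝ (WithLp 2 (L2R × L2R)) where
  carrier := {p | HasWeakDeriv p.fst p.snd}
  zero_mem' := by
    intro ψ _
    have h0 : ((0 : L2R) : ℝ → ℝ) =ᵐ[volume] 0 := Lp.coeFn_zero ℝ 2 volume
    have h1 : ∀ χ : ℝ → ℝ, ∫ x, (0 : L2R) x * χ x = 0 := by
      intro χ
      refine integral_eq_zero_of_ae ?_
      filter_upwards [h0] with x hx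
      simp only [hx, Pi.zero_apply, zero_mul]
    change ∫ x, (0 : L2R) x * deriv ψ x = - ∫ x, (0 : L2R) x * ψ x
    rw [h1, h1, neg_zero]
  add_mem' := by
    intro p q hp hq ψ hψ
    have key : ∀ (f g : L2R) {χ : ℝ → ℝ}, IsTestFunction χ →
        ∫ x, (f + g) x * χ x = (∫ x, f x * χ x) + ∫ x, g x * χ x := by
      intro f g χ hχ
      rw [← integral_add (hχ.integrable_mul f) (hχ.integrable_mul g)]
      refine integral_congr_ae ?_
      filter_upwards [Lp.coeFn_add f g] with x hx
      rw [hx, Pi.add_apply, add_mul]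
    change ∫ x, (p.fst + q.fst) x * deriv ψ x = - ∫ x, (p.snd + q.snd) x * ψ x
    rw [key _ _ hψ.deriv, key _ _ hψ, hp ψ hψ, hq ψ hψ, neg_add]
  smul_mem' := by
    intro c p hp ψ hψ
    have key : ∀ (f : L2R) (χ : ℝ → ℝ), ∫ x, (c • f) x * χ x = c * ∫ x, f x * χ x := by
      intro f χ
      rw [← integral_const_mul]
      refine integral_congr_ae ?_
      filter_upwards [Lp.coeFn_smul c f] with x hx
      rw [hx, Pi.smul_apply, smul_eq_mul, mul_assoc]
    change ∫ x, (c • p.fst) x * deriv ψ x = - ∫ x, (c • p.snd) x * ψ x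
    rw [key, key, hp ψ hψ, mul_neg]

/-- The underlying `L²` function of an element of `H¹(ℝ)`. -/
def l2Val (u : H1R) : L2R := (u : WithLp 2 (L2R × L2R)).fst

/-- The weak derivative `u_x` of an element `u` of `H¹(ℝ)`. -/
def l2Dx (u : H1R) : L2R := (u : WithLp 2 (L2R × L2R)).snd

/-- `(u, w, n, v)`, with `w = u_t`, is a solution of the one-dimensional Klein-Gordon-Zakharov
system
`u_tt - u_xx + u = - n u`, `n_t + v_x = 0`, `v_t + (n + u²)_x = 0` on `[0, ∞) × ℝ`
in the class `C([0, ∞), H¹ × L² × L² × L²)`. The equations hold in the sense of distributions: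
tested against any `ψ ∈ C_c^∞(ℝ)`, for every time `t ≥ 0` (one-sided time derivative at `t = 0`). -/
structure IsKGZSolution (u : ℝ → H1R) (w n v : ℝ → L2R) : Prop where
  continuousOn_u : ContinuousOn u (Ici 0)
  continuousOn_w : ContinuousOn w (Ici 0)
  continuousOn_n : ContinuousOn n (Ici 0)
  continuousOn_v : ContinuousOn v (Ici 0)
  /-- `u_t = w` -/
  eq_u : ∀ ψ : ℝ → ℝ, IsTestFunction ψ → ∀ t : ℝ, 0 ≤ t →
    HasDerivWithinAt (fun s => ∫ x, l2Val (u s) x * ψ x) (∫ x, w t x * ψ x) (Ici 0) t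
  /-- `w_t = u_xx - u - n u` -/
  eq_w : ∀ ψ : ℝ → ℝ, IsTestFunction ψ → ∀ t : ℝ, 0 ≤ t →
    HasDerivWithinAt (fun s => ∫ x, w s x * ψ x)
      ((∫ x, l2Val (u t) x * deriv (deriv ψ) x) - (∫ x, l2Val (u t) x * ψ x)
        - ∫ x, n t x * l2Val (u t) x * ψ x) (Ici 0) t
  /-- `n_t = - v_x` -/
  eq_n : ∀ ψ : ℝ → ℝ, IsTestFunction ψ → ∀ t : ℝ, 0 ≤ t →
    HasDerivWithinAt (fun s => ∫ x, n s x * ψ x) (∫ x, v t x * deriv ψ x) (Ici 0) t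
  /-- `v_t = - (n + u²)_x` -/
  eq_v : ∀ ψ : ℝ → ℝ, IsTestFunction ψ → ∀ t : ℝ, 0 ≤ t →
    HasDerivWithinAt (fun s => ∫ x, v s x * ψ x)
      (∫ x, (n t x + l2Val (u t) x ^ 2) * deriv ψ x) (Ici 0) t

/-- An `L²` function is odd (almost everywhere, as a class of functions). -/
def IsOddL2 (f : L2R) : Prop := ∀ᵐ x : ℝ, f (-x) = - f x

/-- The norm of `L²([a, b])`. -/
def normL2On (a b : ℝ) (f : L2R) : ℝ := Real.sqrt (∫ x in Icc a b, f x ^ 2)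

/-- The norm of `H¹([a, b])`. -/
def normH1On (a b : ℝ) (u : H1R) : ℝ :=
  Real.sqrt (∫ x in Icc a b, (l2Val u x ^ 2 + l2Dx u x ^ 2))

end

/-! The engine is a virial identity for a localized momentum (`IsKGZCurve.hasDeriv_virial`). With φ
= sgn(x)(1 - e^{-|x|}), the functional V = 2∫φ u_x u_t + ∫φ' u u_t - ∫φ n v satisfies -V' = 2∫φ'
u_x² + ∫φ'' u u_x + ½∫φ'(n² + v²) + ∫φ' u² n, because the two cubic terms weighted by φ itself
cancel.

Oddness makes the part in u alone coercive (`IsOddL2.exists_coercive`): since u(0) = 0, it equals 2W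
with W = ∫ |(e^{-|x|/2} u)_x|². Integration by parts then shows that W controls ∫e^{-2|x|}(u² +
u_x²), and ∫e^{-|x|}u⁴ with the small factor 16‖u‖². For ‖u‖ ≤ 1/4 the cubic term is therefore
absorbed. The missing u_t² comes from the derivative of ∫e^{-2|x|} u u_t.

Thus the energy localized by e^{-2|x|} is dominated by the time derivative of a functional.
Conservation of the energy bounds u_t, n, v in L², so that functional is bounded and the localized
energy is Lipschitz in time; a Barbalat argument (`tendsto_zero_of_le_deriv`) sends the latter to
zero.

At energy regularity these identities are only formal. They are proved for Steklov averages in x,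
which lie in H¹ and are differentiable in time with values in L², and the step h of the average then
tends to 0 (`hasDerivWithinAt_of_continuous_family`). -/

noncomputable section

/-! ### Absolutely continuous functions and integrals over the line -/

/-- `P` is locally absolutely continuous and `p` is its almost everywhere derivative. -/
structure IsPrimitive (P p : ℝ → ℝ) : Prop where
  ac : ∀ a b, AbsolutelyContinuousOnInterval P a b
  hasDerivAt : ∀ᵐ x, HasDerivAt P (p x) x

theorem LocallyIntegrable.intervalIntegrable {p : ℝ → ℝ} (hp : LocallyIntegrable p) {a b : ℝ} :
    IntervalIntegrable p volume a b :=
  (hp.integrableOn_isCompact isCompact_uIcc).intervalIntegrable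

namespace IsPrimitive

variable {P p Q q : ℝ → ℝ}

theorem congr (h : IsPrimitive P p) (hq : p =ᵐ[volume] q) : IsPrimitive P q :=
  ⟨h.ac, by filter_upwards [h.hasDerivAt, hq] with x hx hx'; rwa [← hx']⟩

theorem deriv_ae (h : IsPrimitive P p) : deriv P =ᵐ[volume] p := by
  filter_upwards [h.hasDerivAt] with x hx using hx.deriv

theorem integral_eq_sub (h : IsPrimitive P p) (a b : ℝ) : ∫ x in a..b, p x = P b - P a := by
  rw [← (h.ac a b).integral_deriv_eq_sub]
  refine intervalIntegral.integral_congr_ae ?_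
  filter_upwards [h.deriv_ae] with x hx _ using hx.symm

theorem continuous (h : IsPrimitive P p) : Continuous P := by
  refine continuous_iff_continuousAt.2 fun x => ?_
  refine ((h.ac (x - 1) (x + 1)).continuousOn).continuousAt ?_
  rw [uIcc_of_le (by linarith)]
  exact Icc_mem_nhds (by linarith) (by linarith)

theorem mul (h : IsPrimitive P p) (h' : IsPrimitive Q q) :
    IsPrimitive (fun x => P x * Q x) (fun x => p x * Q x + P x * q x) :=
  ⟨fun a b => (h.ac a b).fun_mul (h'.ac a b), by
    filter_upwards [h.hasDerivAt, h'.hasDerivAt] with x hx hx' using hx.mul hx'⟩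

theorem of_integral (hp : LocallyIntegrable p) (h : ∀ x, P x = P 0 + ∫ t in (0 : ℝ)..x, p t) :
    IsPrimitive P p := by
  have hP : P = fun x => P 0 + ∫ t in (0 : ℝ)..x, p t := funext h
  constructor
  · intro a b
    have h1 : AbsolutelyContinuousOnInterval (fun _ : ℝ => P 0) a b :=
      (contDiff_const.contDiffOn).absolutelyContinuousOnInterval
    have h2 : AbsolutelyContinuousOnInterval (fun x => ∫ t in (0 : ℝ)..x, p t) a b :=
      ((((LocallyIntegrable.intervalIntegrable hp)).absolutelyContinuousOnInterval_intervalIntegral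
          (a := min 0 (min a b)) (b := max 0 (max a b)) (c := 0)
          (by rw [uIcc_of_le (by simp)]; simp)).mono (by
            rw [uIcc_of_le (a := min 0 (min a b)) (by simp)]
            refine Icc_subset_Icc ?_ ?_ <;> simp))
    rw [hP]
    exact h1.add h2
  · filter_upwards [LocallyIntegrable.ae_hasDerivAt_integral hp] with x hx
    rw [hP]
    exact (hx 0).const_add _

theorem of_continuous (hP : Continuous P) (hp : LocallyIntegrable p)
    (h : ∀ x, x ≠ 0 → HasDerivAt P (p x) x) : IsPrimitive P p := by
  refine of_integral hp fun x => ?_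
  rw [integral_eq_of_hasDerivAt_off_countable P p (s := {0}) (countable_singleton 0)
    hP.continuousOn (fun y hy => h y hy.2) (LocallyIntegrable.intervalIntegrable hp)]
  ring

/-- Integrability of `p` gives `P` a limit at +∞, and an integrable function can only have the limit
0 there, half-lines having infinite measure. -/
theorem eq_neg_integral_Ioi (h : IsPrimitive P p) (hP : Integrable P) (hp : Integrable p)
    (x : ℝ) : P x = - ∫ y in Ioi x, p y := by
  have htop : Tendsto P atTop (𝓝 (P x + ∫ y in Ioi x, p y)) := by
    have := (intervalIntegral_tendsto_integral_Ioi x hp.integrableOn tendsto_id).const_add (P x)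
    refine this.congr fun y => ?_
    simp [h.integral_eq_sub]
  have h1 := IntegrableAtFilter.eq_zero_of_tendsto (l := atTop) (μ := volume)
    (hP.integrableAtFilter _) (fun s hs => by
      obtain ⟨a, ha⟩ := mem_atTop_sets.1 hs
      exact measure_mono_top (fun x hx => ha x hx) (Real.volume_Ici (a := a))) htop
  linarith

theorem eq_integral_Iic (h : IsPrimitive P p) (hP : Integrable P) (hp : Integrable p)
    (x : ℝ) : P x = ∫ y in Iic x, p y := by
  have hbot : Tendsto P atBot (𝓝 (P x - ∫ y in Iic x, p y)) := by
    have := (intervalIntegral_tendsto_integral_Iic x hp.integrableOn tendsto_id).const_sub (P x)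
    refine this.congr fun y => ?_
    simp [h.integral_eq_sub]
  have h2 := IntegrableAtFilter.eq_zero_of_tendsto (l := atBot) (μ := volume)
    (hP.integrableAtFilter _) (fun s hs => by
      obtain ⟨a, ha⟩ := mem_atBot_sets.1 hs
      exact measure_mono_top (fun x hx => ha x hx) (Real.volume_Iic (a := a))) hbot
  linarith

theorem integral_eq_zero (h : IsPrimitive P p) (hP : Integrable P) (hp : Integrable p) :
    ∫ x, p x = 0 := by
  rw [← intervalIntegral.integral_Iic_add_Ioi (b := (0 : ℝ)) hp.integrableOn hp.integrableOn,
    ← h.eq_integral_Iic hP hp, h.eq_neg_integral_Ioi hP hp]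
  ring

end IsPrimitive

/-! ### Test functions, the du Bois-Reymond lemma and weak derivatives -/

namespace IsTestFunction

variable {ψ χ : ℝ → ℝ}

theorem continuous (h : IsTestFunction ψ) : Continuous ψ := h.smooth.continuous

theorem isPrimitive (h : IsTestFunction ψ) : IsPrimitive ψ (_root_.deriv ψ) :=
  IsPrimitive.of_continuous h.continuous h.deriv.continuous.locallyIntegrable fun x _ =>
    (h.smooth.differentiable (by simp) x).hasDerivAt

theorem integrable (h : IsTestFunction ψ) : Integrable ψ :=
  h.continuous.integrable_of_hasCompactSupport h.compactSupport

theorem exists_support_subset (h : IsTestFunction ψ) : ∃ R : ℝ, 0 < R ∧ ∀ x, R ≤ |x| → ψ x = 0 := by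
  obtain ⟨R, hR⟩ := h.compactSupport.isBounded.subset_closedBall 0
  refine ⟨|R| + 1, by positivity, fun x hx => ?_⟩
  refine image_eq_zero_of_notMem_tsupport fun hx' => ?_
  have := hR hx'
  rw [mem_closedBall_zero_iff, Real.norm_eq_abs] at this
  linarith [le_abs_self R]

/-- An antiderivative of a test function is smooth. -/
theorem contDiff_integral (h : IsTestFunction ψ) (a : ℝ) :
    ContDiff ℝ ∞ (fun x => ∫ t in a..x, ψ t) := by
  have hd : ∀ x, HasDerivAt (fun x => ∫ t in a..x, ψ t) (ψ x) x := fun x =>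
    (h.continuous.integral_hasStrictDerivAt a x).hasDerivAt
  rw [contDiff_infty_iff_deriv]
  refine ⟨fun x => (hd x).differentiableAt, ?_⟩
  rw [funext fun x => (hd x).deriv]
  exact h.smooth

theorem of_support {R : ℝ} (hs : ContDiff ℝ ∞ ψ) (hR : ∀ x, R < |x| → ψ x = 0) :
    IsTestFunction ψ :=
  ⟨hs, HasCompactSupport.intro (isCompact_closedBall (0 : ℝ) R) fun x hx => hR x (by
    simpa using hx)⟩

/-- A test function with vanishing integral is the derivative of a test function. -/
theorem exists_deriv_eq (h : IsTestFunction ψ) (h0 : ∫ x, ψ x = 0) :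
    ∃ χ, IsTestFunction χ ∧ _root_.deriv χ = ψ := by
  obtain ⟨R, hR, hψ⟩ := h.exists_support_subset
  refine ⟨fun x => ∫ t in (-R)..x, ψ t, of_support (R := R) (h.contDiff_integral _) ?_,
    funext fun x => (h.continuous.integral_hasStrictDerivAt _ x).hasDerivAt.deriv⟩
  intro x hx
  rcases lt_abs.1 hx with hx | hx
  · rw [← h0]
    refine intervalIntegral.integral_eq_integral_of_support_subset fun y hy => ?_
    have : |y| < R := by
      by_contra hy'
      exact hy (hψ y (not_lt.1 hy'))
    rw [abs_lt] at this
    exact ⟨this.1, by linarith⟩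
  · refine (intervalIntegral.integral_congr fun y hy => ?_).trans
      (intervalIntegral.integral_zero)
    rw [uIcc_of_ge (by linarith)] at hy
    exact hψ y (le_abs.2 (Or.inr (by linarith [hy.2])))

theorem const_mul (h : IsTestFunction ψ) (c : ℝ) : IsTestFunction (fun x => c * ψ x) :=
  ⟨contDiff_const.mul h.smooth, h.compactSupport.mul_left⟩

theorem sub (h : IsTestFunction ψ) (h' : IsTestFunction χ) :
    IsTestFunction (fun x => ψ x - χ x) :=
  ⟨h.smooth.sub h'.smooth, h.compactSupport.sub h'.compactSupport⟩

end IsTestFunction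

theorem exists_isTestFunction_integral_eq_one : ∃ ψ, IsTestFunction ψ ∧ ∫ x, ψ x = 1 := by
  let f : ContDiffBump (0 : ℝ) := ⟨1, 2, by norm_num, by norm_num⟩
  exact ⟨f.normed volume, ⟨f.contDiff_normed, f.hasCompactSupport_normed⟩, f.integral_normed⟩

theorem LocallyIntegrable.integrable_mul_test {k ψ : ℝ → ℝ} (hk : LocallyIntegrable k)
    (h : IsTestFunction ψ) : Integrable (fun x => k x * ψ x) := by
  simpa [mul_comm] using
    hk.integrable_smul_left_of_hasCompactSupport h.continuous h.compactSupport

/-- The lemma of du Bois-Reymond. -/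
theorem ae_eq_const_of_integral_mul_deriv_eq_zero {k : ℝ → ℝ} (hk : LocallyIntegrable k)
    (h : ∀ ψ, IsTestFunction ψ → ∫ x, k x * deriv ψ x = 0) : ∃ c, k =ᵐ[volume] fun _ => c := by
  obtain ⟨η, hη, hη1⟩ := exists_isTestFunction_integral_eq_one
  refine ⟨∫ x, k x * η x, ?_⟩
  refine ae_eq_of_integral_contDiff_smul_eq hk (locallyIntegrable_const _) fun χ h1 h2 => ?_
  have hχ : IsTestFunction χ := ⟨h1, h2⟩
  -- Subtracting a multiple of `η` gives `χ` mean zero, which makes it the derivative of a test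
  -- function.
  obtain ⟨ψ, hψ, hd⟩ := (hχ.sub (hη.const_mul (∫ x, χ x))).exists_deriv_eq (by
    rw [integral_sub hχ.integrable (hη.integrable.const_mul _), integral_const_mul, hη1]; ring)
  have := h ψ hψ
  simp only [hd, mul_sub] at this
  rw [integral_sub (LocallyIntegrable.integrable_mul_test hk hχ)
    (LocallyIntegrable.integrable_mul_test hk (hη.const_mul _))] at this
  simp only [smul_eq_mul]
  rw [integral_mul_const]
  have h3 : ∫ x, k x * ((∫ y, χ y) * η x) = (∫ y, χ y) * ∫ x, k x * η x := by
    rw [← integral_const_mul]; congr 1; ext x; ring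
  rw [h3] at this
  simp only [mul_comm (χ _)]
  linarith

theorem L2R.locallyIntegrable (f : L2R) : LocallyIntegrable f :=
  (Lp.memLp f).locallyIntegrable (by norm_num)

theorem IsPrimitive.integral_mul_deriv {P p ψ : ℝ → ℝ} (h : IsPrimitive P p)
    (hp : LocallyIntegrable p) (hψ : IsTestFunction ψ) :
    ∫ x, P x * deriv ψ x = - ∫ x, p x * ψ x := by
  have i1 := LocallyIntegrable.integrable_mul_test hp hψ
  have i2 := LocallyIntegrable.integrable_mul_test h.continuous.locallyIntegrable hψ.deriv
  have := (h.mul hψ.isPrimitive).integral_eq_zero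
    (LocallyIntegrable.integrable_mul_test h.continuous.locallyIntegrable hψ) (i1.add i2)
  rw [integral_add i1 i2] at this
  linarith

theorem HasWeakDeriv.exists_isPrimitive {f g : L2R} (h : HasWeakDeriv f g) :
    ∃ P, IsPrimitive P g ∧ f =ᵐ[volume] P := by
  have hG : IsPrimitive (fun x => ∫ t in (0 : ℝ)..x, g t) g :=
    IsPrimitive.of_integral (L2R.locallyIntegrable g) fun x => by simp
  obtain ⟨c, hc⟩ := ae_eq_const_of_integral_mul_deriv_eq_zero
    (k := fun x => f x - ∫ t in (0 : ℝ)..x, g t)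
    ((L2R.locallyIntegrable f).sub hG.continuous.locallyIntegrable) fun ψ hψ => by
      simp only [sub_mul]
      rw [integral_sub (hψ.deriv.integrable_mul f) (LocallyIntegrable.integrable_mul_test
        hG.continuous.locallyIntegrable hψ.deriv), h ψ hψ,
        hG.integral_mul_deriv (L2R.locallyIntegrable g) hψ]
      ring
  refine ⟨fun x => c + ∫ t in (0 : ℝ)..x, g t,
    IsPrimitive.of_integral (L2R.locallyIntegrable g) fun x => by simp, ?_⟩
  filter_upwards [hc] with x hx
  linarith

theorem IsPrimitive.hasWeakDeriv {P p : ℝ → ℝ} {f g : L2R} (h : IsPrimitive P p)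
    (hf : f =ᵐ[volume] P) (hg : g =ᵐ[volume] p) : HasWeakDeriv f g := by
  intro ψ hψ
  have h' := h.congr hg.symm
  rw [← h'.integral_mul_deriv (L2R.locallyIntegrable g) hψ]
  refine integral_congr_ae ?_
  filter_upwards [hf] with x hx
  rw [hx]

/-! ### The sign function and weights with a kink at the origin -/

/-- The sign of `x`, with value `1` at `0`. -/
def sgn (x : ℝ) : ℝ := if 0 ≤ x then 1 else -1

theorem sgn_mul_self (x : ℝ) : sgn x * sgn x = 1 := by unfold sgn; split_ifs <;> norm_num

theorem abs_sgn (x : ℝ) : |sgn x| = 1 := by unfold sgn; split_ifs <;> norm_num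

theorem measurable_sgn : Measurable sgn :=
  Measurable.ite measurableSet_Ici measurable_const measurable_const

theorem sgn_of_nonneg {x : ℝ} (h : 0 ≤ x) : sgn x = 1 := if_pos h

theorem sgn_of_neg {x : ℝ} (h : x < 0) : sgn x = -1 := if_neg (not_le.2 h)

theorem LocallyIntegrable.sgn_mul {p : ℝ → ℝ} (hp : LocallyIntegrable p) :
    LocallyIntegrable (fun x => sgn x * p x) := by
  refine hp.mono (measurable_sgn.aestronglyMeasurable.mul hp.aestronglyMeasurable) ?_
  refine Eventually.of_forall fun x => ?_
  simp [abs_sgn]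

/-- The vanishing of `P` at 0 removes the jump of the product, so no Dirac mass appears. Oddness of
the solution is exploited through this lemma. -/
theorem IsPrimitive.sgn_mul {P p : ℝ → ℝ} (h : IsPrimitive P p) (hp : LocallyIntegrable p)
    (h0 : P 0 = 0) : IsPrimitive (fun x => sgn x * P x) (fun x => sgn x * p x) := by
  refine IsPrimitive.of_integral (LocallyIntegrable.sgn_mul hp) fun x => ?_
  have key : ∫ t in (0 : ℝ)..x, sgn t * p t = sgn x * ∫ t in (0 : ℝ)..x, p t := by
    rw [← intervalIntegral.integral_const_mul]
    refine intervalIntegral.integral_congr_ae ?_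
    filter_upwards [compl_mem_ae_iff.2 (measure_singleton (0 : ℝ))] with t ht0 ht
    rcases le_or_gt 0 x with hx | hx
    · rw [uIoc_of_le hx] at ht
      rw [sgn_of_nonneg hx, sgn_of_nonneg ht.1.le]
    · rw [uIoc_of_ge hx.le] at ht
      rw [sgn_of_neg hx, sgn_of_neg (lt_of_le_of_ne ht.2 ht0)]
  simp only [key, h.integral_eq_sub, h0]
  ring

theorem isPrimitive_exp_neg_abs (c : ℝ) :
    IsPrimitive (fun x => Real.exp (-(c * |x|))) (fun x => -(c * (sgn x * Real.exp (-(c * |x|))))) := by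
  have hc : Continuous fun x : ℝ => Real.exp (-(c * |x|)) := by fun_prop
  refine IsPrimitive.of_continuous hc ?_ fun x hx => ?_
  · convert! (LocallyIntegrable.sgn_mul hc.locallyIntegrable).smul (-c) using 1
    ext y
    simp
  · have h1 : HasDerivAt (fun x : ℝ => |x|) (sgn x) x := by
      rcases lt_or_gt_of_ne hx with h | h
      · rw [sgn_of_neg h]; exact hasDerivAt_abs_neg h
      · rw [sgn_of_nonneg h.le]; exact hasDerivAt_abs_pos h
    convert! ((h1.const_mul c).neg).exp using 1
    simp only [Pi.neg_apply]
    ring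

/-! ### Translations and Steklov averages in L² -/

/-- A test function, as an element of `L²(ℝ)`. -/
def IsTestFunction.toL2 {ψ : ℝ → ℝ} (h : IsTestFunction ψ) : L2R :=
  (h.smooth.continuous.memLp_of_hasCompactSupport h.compactSupport).toLp ψ

theorem L2R.inner_eq_integral (f g : L2R) : inner ℝ f g = ∫ x, f x * g x := by
  rw [L2.inner_def]
  simp [mul_comm]

theorem L2R.integrable_mul (f g : L2R) : Integrable fun x => f x * g x :=
  (Lp.memLp f).integrable_mul (q := 2) (Lp.memLp g)

theorem IsTestFunction.coeFn_toL2 {ψ : ℝ → ℝ} (h : IsTestFunction ψ) : h.toL2 =ᵐ[volume] ψ :=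
  MemLp.coeFn_toLp _

theorem IsTestFunction.inner_toL2 {ψ : ℝ → ℝ} (h : IsTestFunction ψ) (f : L2R) :
    inner ℝ h.toL2 f = ∫ x, f x * ψ x := by
  rw [L2R.inner_eq_integral]
  refine integral_congr_ae ?_
  filter_upwards [h.coeFn_toL2] with x hx
  rw [hx, mul_comm]

theorem L2R.ext_test {f g : L2R}
    (h : ∀ ψ, IsTestFunction ψ → ∫ x, f x * ψ x = ∫ x, g x * ψ x) : f = g := by
  refine Lp.ext (ae_eq_of_integral_contDiff_smul_eq (L2R.locallyIntegrable f)
    (L2R.locallyIntegrable g) fun ψ h1 h2 => ?_)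
  simpa only [smul_eq_mul, mul_comm] using h ψ ⟨h1, h2⟩

/-- Translation `f ↦ f (· + y)` on `L²(ℝ)`. -/
def translateL2 (y : ℝ) : L2R →L[ℝ] L2R :=
  (Lp.compMeasurePreservingₗᵢ ℝ (fun x : ℝ => x + y)
    (measurePreserving_add_right volume y)).toContinuousLinearMap

theorem coeFn_translateL2 (y : ℝ) (f : L2R) : translateL2 y f =ᵐ[volume] fun x => f (x + y) :=
  Lp.coeFn_compMeasurePreserving f (measurePreserving_add_right volume y)

theorem continuous_translateL2 : Continuous fun p : ℝ × L2R => translateL2 p.1 p.2 := by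
  let g : C(ℝ, C(ℝ, ℝ)) := (ContinuousMap.mk (fun a : ℝ × ℝ => a.2 + a.1) (by fun_prop)).curry
  exact continuous_snd.compMeasurePreservingLp (g.continuous.comp continuous_fst)
    (fun p => measurePreserving_add_right volume p.1) ENNReal.ofNat_ne_top

theorem integral_translateL2_mul (y : ℝ) (f : L2R) (ψ : ℝ → ℝ) :
    ∫ x, translateL2 y f x * ψ x = ∫ x, f x * ψ (x - y) := by
  rw [← integral_add_right_eq_self (fun x => f x * ψ (x - y)) y]
  refine integral_congr_ae ?_
  filter_upwards [coeFn_translateL2 y f] with x hx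
  simp [hx]

theorem IsTestFunction.comp_sub {ψ : ℝ → ℝ} (h : IsTestFunction ψ) (y : ℝ) :
    IsTestFunction fun x => ψ (x - y) :=
  ⟨h.smooth.comp (contDiff_id.sub contDiff_const),
    h.compactSupport.comp_homeomorph (Homeomorph.subRight y)⟩

/-- The Steklov average of `f` over the intervals `[x, x + h]`. -/
def steklov (h : ℝ) (f : L2R) : L2R := ∫ y in (0 : ℝ)..1, translateL2 (h * y) f

/-- The difference quotient with step `h`. -/
def diffQuot (h : ℝ) : L2R →L[ℝ] L2R := h⁻¹ • (translateL2 h - ContinuousLinearMap.id ℝ L2R)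

/-- The Steklov average of a test function, over the intervals `[x - h, x]`. -/
def testAverage (h : ℝ) (ψ : ℝ → ℝ) (x : ℝ) : ℝ := ∫ y in (0 : ℝ)..1, ψ (x - h * y)

/-- Joint continuity includes h = 0, where the average is the identity; this is what lets the
regularization be removed. -/
theorem continuous_steklov : Continuous fun p : ℝ × L2R => steklov p.1 p.2 := by
  refine intervalIntegral.continuous_parametric_intervalIntegral_of_continuous'
    (f := fun (p : ℝ × L2R) y => translateL2 (p.1 * y) p.2) ?_ 0 1
  exact continuous_translateL2.comp (by fun_prop :
    Continuous fun q : (ℝ × L2R) × ℝ => (q.1.1 * q.2, q.1.2))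

theorem steklov_zero (f : L2R) : steklov 0 f = f := by
  have : translateL2 0 f = f := by
    refine Lp.ext ?_
    filter_upwards [coeFn_translateL2 0 f] with x hx
    simp [hx]
  simp [steklov, this]

theorem testAverage_eq {h : ℝ} (hh : h ≠ 0) {ψ : ℝ → ℝ} (hψ : IsTestFunction ψ) :
    testAverage h ψ = fun x => h⁻¹ * ((∫ t in (0 : ℝ)..x, ψ t) - ∫ t in (0 : ℝ)..(x - h), ψ t) := by
  ext x
  rw [testAverage, intervalIntegral.integral_comp_sub_mul _ hh,
    intervalIntegral.integral_interval_sub_left (hψ.continuous.intervalIntegrable _ _)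
      (hψ.continuous.intervalIntegrable _ _)]
  simp

theorem deriv_testAverage {h : ℝ} (hh : h ≠ 0) {ψ : ℝ → ℝ} (hψ : IsTestFunction ψ) :
    deriv (testAverage h ψ) = fun x => h⁻¹ * (ψ x - ψ (x - h)) := by
  rw [testAverage_eq hh hψ]
  ext x
  have hd : ∀ x, HasDerivAt (fun x => ∫ t in (0 : ℝ)..x, ψ t) (ψ x) x := fun x =>
    (hψ.continuous.integral_hasStrictDerivAt 0 x).hasDerivAt
  exact (((hd x).sub ((hd (x - h)).comp_sub_const x h)).const_mul h⁻¹).deriv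

theorem IsTestFunction.testAverage {h : ℝ} (hh : h ≠ 0) {ψ : ℝ → ℝ} (hψ : IsTestFunction ψ) :
    IsTestFunction (testAverage h ψ) := by
  obtain ⟨R, hR, hs⟩ := hψ.exists_support_subset
  refine IsTestFunction.of_support (R := R + |h|) ?_ fun x hx => ?_
  · rw [testAverage_eq hh hψ]
    exact contDiff_const.mul ((hψ.contDiff_integral 0).sub
      ((hψ.contDiff_integral 0).comp (contDiff_id.sub contDiff_const)))
  · refine (intervalIntegral.integral_congr fun y hy => ?_).trans intervalIntegral.integral_zero
    rw [uIcc_of_le zero_le_one] at hy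
    refine hs _ ?_
    have h1 : |h * y| ≤ |h| := by
      rw [abs_mul, abs_of_nonneg hy.1]
      exact mul_le_of_le_one_right (abs_nonneg _) hy.2
    linarith [abs_sub_abs_le_abs_sub x (h * y)]

theorem deriv_testAverage_comm {h : ℝ} (hh : h ≠ 0) {ψ : ℝ → ℝ} (hψ : IsTestFunction ψ) :
    deriv (testAverage h ψ) = testAverage h (deriv ψ) := by
  rw [deriv_testAverage hh hψ, testAverage_eq hh hψ.deriv]
  ext x
  rw [hψ.isPrimitive.integral_eq_sub, hψ.isPrimitive.integral_eq_sub]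
  ring

theorem integral_steklov_mul (h : ℝ) (f : L2R) {ψ : ℝ → ℝ} (hψ : IsTestFunction ψ) :
    ∫ x, steklov h f x * ψ x = ∫ x, f x * testAverage h ψ x := by
  obtain ⟨R, hR, hs⟩ := hψ.exists_support_subset
  have hc : Continuous fun y : ℝ => translateL2 (h * y) f :=
    continuous_translateL2.comp (by fun_prop : Continuous fun y : ℝ => (h * y, f))
  have e1 : ∫ x, steklov h f x * ψ x = ∫ y in (0 : ℝ)..1, ∫ x, f x * ψ (x - h * y) := by
    rw [← hψ.inner_toL2, steklov]
    change innerSL ℝ hψ.toL2 _ = _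
    rw [← ContinuousLinearMap.intervalIntegral_comp_comm _ (hc.intervalIntegrable _ _)]
    refine intervalIntegral.integral_congr fun y _ => ?_
    change inner ℝ hψ.toL2 _ = _
    rw [hψ.inner_toL2, integral_translateL2_mul]
  obtain ⟨B, hB⟩ := hψ.continuous.bounded_above_of_compact_support hψ.compactSupport
  have hint : Integrable (Function.uncurry fun x y => f x * ψ (x - h * y))
      ((volume : Measure ℝ).prod (volume.restrict (Ioc (0 : ℝ) 1))) := by
    -- `f` is only in L², so it is cut off to a compact interval containing the supports of all the
    -- translates of `ψ` that occur.
    have hK : Integrable ((Icc (-(R + |h|)) (R + |h|)).indicator f) :=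
      ((L2R.locallyIntegrable f).integrableOn_isCompact isCompact_Icc).integrable_indicator
        measurableSet_Icc
    have hbd : Integrable (fun _ : ℝ => B) (volume.restrict (Ioc (0 : ℝ) 1)) :=
      integrable_const B
    refine (hK.mul_prod hbd).mono ?_ ?_
    · refine AEStronglyMeasurable.mul ?_ ?_
      · exact (Lp.aestronglyMeasurable f).comp_fst
      · exact (hψ.continuous.comp (by fun_prop :
          Continuous fun p : ℝ × ℝ => p.1 - h * p.2)).aestronglyMeasurable
    · have hy : ∀ᵐ p : ℝ × ℝ ∂((volume : Measure ℝ).prod (volume.restrict (Ioc (0 : ℝ) 1))),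
          p.2 ∈ Ioc (0 : ℝ) 1 :=
        Measure.quasiMeasurePreserving_snd.ae (ae_restrict_mem measurableSet_Ioc)
      filter_upwards [hy] with p hp
      simp only [Function.uncurry, norm_mul]
      by_cases hx : p.1 ∈ Icc (-(R + |h|)) (R + |h|)
      · rw [indicator_of_mem hx]
        gcongr
        exact (hB _).trans (le_abs_self B)
      · rw [hs (p.1 - h * p.2), norm_zero, mul_zero]
        · positivity
        have h1 : |h * p.2| ≤ |h| := by
          rw [abs_mul, abs_of_pos hp.1]
          exact mul_le_of_le_one_right (abs_nonneg _) hp.2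
        have h2 : R + |h| < |p.1| := by
          by_contra hcon
          exact hx (abs_le.1 (not_lt.1 hcon))
        linarith [abs_sub_abs_le_abs_sub p.1 (h * p.2)]
  rw [e1, intervalIntegral.integral_of_le zero_le_one, ← integral_integral_swap hint]
  refine integral_congr_ae (ae_of_all _ fun x => ?_)
  simp only [testAverage]
  rw [intervalIntegral.integral_of_le zero_le_one, integral_const_mul]

theorem integral_mul_deriv_testAverage {h : ℝ} (hh : h ≠ 0) (f : L2R) {ψ : ℝ → ℝ}
    (hψ : IsTestFunction ψ) :
    ∫ x, f x * deriv (testAverage h ψ) x = - ∫ x, diffQuot h f x * ψ x := by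
  rw [deriv_testAverage hh hψ, ← hψ.inner_toL2]
  simp only [diffQuot, smul_apply, sub_apply,
    ContinuousLinearMap.id_apply, inner_smul_right, inner_sub_right]
  simp only [hψ.inner_toL2, integral_translateL2_mul]
  rw [← integral_sub ((hψ.comp_sub h).integrable_mul f) (hψ.integrable_mul f), ← integral_const_mul,
    ← integral_neg]
  congr 1
  ext x
  ring

theorem hasWeakDeriv_steklov {h : ℝ} (hh : h ≠ 0) (f : L2R) :
    HasWeakDeriv (steklov h f) (diffQuot h f) := fun ψ hψ => by
  rw [integral_steklov_mul h f hψ.deriv, ← deriv_testAverage_comm hh hψ,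
    integral_mul_deriv_testAverage hh f hψ]

/-- Averaging u_x amounts to taking a difference quotient of u, which stays in L² and can be
differentiated in time. -/
theorem HasWeakDeriv.steklov_eq {h : ℝ} (hh : h ≠ 0) {f g : L2R} (hfg : HasWeakDeriv f g) :
    steklov h g = diffQuot h f := L2R.ext_test fun ψ hψ => by
  rw [integral_steklov_mul h g hψ, ← neg_eq_iff_eq_neg.2 (hfg _ (hψ.testAverage hh)),
    integral_mul_deriv_testAverage hh f hψ, neg_neg]

/-! ### From distributional identities to time derivatives -/

/-- A continuous curve in `L²(ℝ)` with a continuous distributional derivative is differentiable. -/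
theorem hasDerivWithinAt_of_test {X Y : ℝ → L2R} (hX : Continuous X) (hY : Continuous Y)
    (h : ∀ ψ, IsTestFunction ψ → ∀ t, 0 ≤ t →
      HasDerivWithinAt (fun s => ∫ x, X s x * ψ x) (∫ x, Y t x * ψ x) (Ici 0) t) :
    ∀ t, 0 ≤ t → HasDerivWithinAt X (Y t) (Ici 0) t := by
  -- The tested equations are integrated in time; test functions then separate the two sides as
  -- elements of L².
  have key : ∀ t, 0 ≤ t → X t = X 0 + ∫ s in (0 : ℝ)..t, Y s := by
    intro t ht
    refine L2R.ext_test fun ψ hψ => ?_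
    have hc : ∀ {Z : ℝ → L2R}, Continuous Z → Continuous fun s => ∫ x, Z s x * ψ x := by
      intro Z hZ
      simp only [← hψ.inner_toL2]
      fun_prop
    have e := intervalIntegral.integral_eq_sub_of_hasDeriv_right (a := 0) (b := t)
      (hc hX).continuousOn (fun s hs => by
        rw [min_eq_left ht] at hs
        exact (h ψ hψ s hs.1.le).mono (Ioi_subset_Ici_self.trans (Ici_subset_Ici.2 hs.1.le)))
      ((hc hY).intervalIntegrable _ _)
    rw [← hψ.inner_toL2 (_ + _), inner_add_right, hψ.inner_toL2]
    have e2 : inner ℝ hψ.toL2 (∫ s in (0 : ℝ)..t, Y s) = ∫ s in (0 : ℝ)..t, ∫ x, Y s x * ψ x := by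
      change innerSL ℝ hψ.toL2 _ = _
      rw [← ContinuousLinearMap.intervalIntegral_comp_comm _ (hY.intervalIntegrable _ _)]
      refine intervalIntegral.integral_congr fun s _ => hψ.inner_toL2 _
    rw [e2, e]
    ring
  intro t ht
  refine (((hY.integral_hasStrictDerivAt 0 t).hasDerivAt.const_add (X 0)).hasDerivWithinAt).congr
    (fun s hs => key s hs) (key t ht)

/-- Passage to the limit in a family of differential identities. -/
theorem hasDerivWithinAt_of_continuous_family {m r : ℝ → ℝ → ℝ}
    (hm : Continuous fun p : ℝ × ℝ => m p.1 p.2) (hr : Continuous fun p : ℝ × ℝ => r p.1 p.2)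
    (h : ∀ a, a ≠ 0 → ∀ t, 0 ≤ t → HasDerivWithinAt (m a) (r a t) (Ici 0) t) :
    ∀ t, 0 ≤ t → HasDerivWithinAt (m 0) (r 0 t) (Ici 0) t := by
  have hm' : ∀ a, Continuous (m a) := fun a => hm.comp (by fun_prop : Continuous fun t => (a, t))
  have hr' : ∀ a, Continuous (r a) := fun a => hr.comp (by fun_prop : Continuous fun t => (a, t))
  -- In integrated form both sides are continuous in `a` and agree on the dense set a ≠ 0, hence
  -- also at a = 0.
  have key : ∀ t, 0 ≤ t → m 0 t = m 0 0 + ∫ s in (0 : ℝ)..t, r 0 s := by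
    intro t ht
    have h1 : Continuous fun a => m a t := hm.comp (by fun_prop : Continuous fun a => (a, t))
    have h2 : Continuous fun a => m a 0 + ∫ s in (0 : ℝ)..t, r a s :=
      (hm.comp (by fun_prop : Continuous fun a : ℝ => (a, (0 : ℝ)))).add
        (intervalIntegral.continuous_parametric_intervalIntegral_of_continuous' hr 0 t)
    refine congrFun (h1.ext_on (dense_compl_singleton (0 : ℝ)) h2 fun a ha => ?_) 0
    have e := intervalIntegral.integral_eq_sub_of_hasDeriv_right (a := 0) (b := t)
      (hm' a).continuousOn (fun s hs => by
        rw [min_eq_left ht] at hs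
        exact (h a ha s hs.1.le).mono (Ioi_subset_Ici_self.trans (Ici_subset_Ici.2 hs.1.le)))
      ((hr' a).intervalIntegrable _ _)
    simp only [e]
    ring
  intro t ht
  refine ((((hr' 0).integral_hasStrictDerivAt 0 t).hasDerivAt.const_add
    (m 0 0)).hasDerivWithinAt).congr (fun s hs => key s hs) (key t ht)

/-! ### Bounded multipliers and the embedding of H¹ in L^∞ -/

theorem L2R.norm_sq_eq_integral (f : L2R) : ‖f‖ ^ 2 = ∫ x, f x * f x := by
  rw [← real_inner_self_eq_norm_sq, L2R.inner_eq_integral]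

/-- Multiplication of an `L²` function by an `L^∞` function. -/
def mulL : Lp ℝ ⊤ (volume : Measure ℝ) →L[ℝ] L2R →L[ℝ] L2R :=
  (ContinuousLinearMap.mul ℝ ℝ).holderL volume ⊤ 2 2

theorem coeFn_mulL (a : Lp ℝ ⊤ (volume : Measure ℝ)) (f : L2R) :
    mulL a f =ᵐ[volume] fun x => a x * f x :=
  ContinuousLinearMap.coeFn_holder _ a f

theorem norm_mulL_le (a : Lp ℝ ⊤ (volume : Measure ℝ)) (f : L2R) : ‖mulL a f‖ ≤ ‖a‖ * ‖f‖ := by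
  refine (ContinuousLinearMap.norm_holder_apply_apply_le _ a f).trans ?_
  simp

theorem inner_mulL (a : Lp ℝ ⊤ (volume : Measure ℝ)) (f g : L2R) :
    inner ℝ (mulL a f) g = ∫ x, a x * f x * g x := by
  rw [L2R.inner_eq_integral]
  refine integral_congr_ae ?_
  filter_upwards [coeFn_mulL a f] with x hx
  rw [hx]

theorem integrable_mulL (a : Lp ℝ ⊤ (volume : Measure ℝ)) (f g : L2R) :
    Integrable fun x => a x * f x * g x := by
  refine (L2R.integrable_mul (mulL a f) g).congr ?_
  filter_upwards [coeFn_mulL a f] with x hx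
  rw [hx]

theorem inner_mulL_comm (a : Lp ℝ ⊤ (volume : Measure ℝ)) (f g : L2R) :
    inner ℝ (mulL a f) g = inner ℝ (mulL a g) f := by
  rw [inner_mulL, inner_mulL]
  congr 1
  ext x
  ring

theorem inner_mulL_right (a : Lp ℝ ⊤ (volume : Measure ℝ)) (f g : L2R) :
    inner ℝ f (mulL a g) = inner ℝ (mulL a f) g := by
  rw [inner_mulL_comm, real_inner_comm]

/-- The value of an element of `H¹(ℝ)`, as a continuous linear map. -/
def valL : H1R →L[ℝ] L2R := (WithLp.fstL 2 ℝ L2R L2R).comp H1R.subtypeL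

/-- The derivative of an element of `H¹(ℝ)`, as a continuous linear map. -/
def dxL : H1R →L[ℝ] L2R := (WithLp.sndL 2 ℝ L2R L2R).comp H1R.subtypeL

theorem hasWeakDeriv_valL (u : H1R) : HasWeakDeriv (valL u) (dxL u) := u.2

theorem H1R.norm_sq_eq (u : H1R) : ‖u‖ ^ 2 = ‖valL u‖ ^ 2 + ‖dxL u‖ ^ 2 :=
  WithLp.prod_norm_sq_eq_of_L2 (u : WithLp 2 (L2R × L2R))

theorem H1R.norm_valL_le (u : H1R) : ‖valL u‖ ≤ ‖u‖ :=
  (sq_le_sq₀ (norm_nonneg _) (norm_nonneg _)).1 (by nlinarith [H1R.norm_sq_eq u])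

theorem H1R.norm_dxL_le (u : H1R) : ‖dxL u‖ ≤ ‖u‖ :=
  (sq_le_sq₀ (norm_nonneg _) (norm_nonneg _)).1 (by nlinarith [H1R.norm_sq_eq u])

/-- The Sobolev embedding `H¹(ℝ) ⊂ L^∞(ℝ)` for the absolutely continuous representative. -/
theorem H1R.exists_isPrimitive (u : H1R) :
    ∃ P, IsPrimitive P (dxL u) ∧ valL u =ᵐ[volume] P ∧ ∀ x, |P x| ≤ ‖u‖ := by
  obtain ⟨P, hP, hae⟩ := (hasWeakDeriv_valL u).exists_isPrimitive
  refine ⟨P, hP, hae, fun x => ?_⟩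
  have i1 : Integrable fun x => P x * P x := by
    refine (L2R.integrable_mul (valL u) (valL u)).congr ?_
    filter_upwards [hae] with x hx
    rw [hx]
  have i2 : Integrable fun x => P x * dxL u x := by
    refine (L2R.integrable_mul (valL u) (dxL u)).congr ?_
    filter_upwards [hae] with x hx
    rw [hx]
  have i3 : Integrable fun x => dxL u x * P x := by simpa only [mul_comm] using i2
  have i4 := L2R.integrable_mul (dxL u) (dxL u)
  have e1 : ∫ x, P x * P x = ‖valL u‖ ^ 2 := by
    rw [L2R.norm_sq_eq_integral]
    refine integral_congr_ae ?_
    filter_upwards [hae] with x hx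
    rw [hx]
  -- P(x)² is the integral of 2PP' over (-∞, x], and 2PP' ≤ P² + P'².
  have key : P x * P x ≤ ‖u‖ ^ 2 := by
    rw [(hP.mul hP).eq_integral_Iic i1 (i3.add i2) x, H1R.norm_sq_eq, ← e1,
      L2R.norm_sq_eq_integral (dxL u), ← integral_add i1 i4]
    refine (setIntegral_mono (i3.add i2).integrableOn (i1.add i4).integrableOn fun y => ?_).trans
      (setIntegral_le_integral (i1.add i4) (ae_of_all _ fun y => ?_))
    · change dxL u y * P y + P y * dxL u y ≤ P y * P y + dxL u y * dxL u y
      nlinarith [sq_nonneg (P y - dxL u y)]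
    · change 0 ≤ P y * P y + dxL u y * dxL u y
      nlinarith [mul_self_nonneg (P y), mul_self_nonneg (dxL u y)]
  exact abs_le_of_sq_le_sq (by nlinarith) (norm_nonneg _)

theorem H1R.ae_abs_le (u : H1R) : ∀ᵐ x, ‖valL u x‖ ≤ ‖u‖ := by
  obtain ⟨P, -, hae, hb⟩ := (H1R.exists_isPrimitive u)
  filter_upwards [hae] with x hx
  rw [hx]
  exact hb x

theorem H1R.memLp_top (u : H1R) : MemLp (valL u) ⊤ volume :=
  memLp_top_of_bound (Lp.aestronglyMeasurable _) _ (H1R.ae_abs_le u)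

/-- The Sobolev embedding `H¹(ℝ) ⊂ L^∞(ℝ)`. -/
def supL : H1R →L[ℝ] Lp ℝ ⊤ (volume : Measure ℝ) :=
  LinearMap.mkContinuous
    { toFun := fun u => (H1R.memLp_top u).toLp _
      map_add' := fun u u' => by
        rw [← MemLp.toLp_add]
        refine MemLp.toLp_congr _ _ ?_
        rw [map_add]
        exact Lp.coeFn_add _ _
      map_smul' := fun c u => by
        rw [RingHom.id_apply, ← MemLp.toLp_const_smul]
        refine MemLp.toLp_congr _ _ ?_
        rw [map_smul]
        exact Lp.coeFn_smul _ _ } 1 fun u => by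
    rw [one_mul]
    change ‖(H1R.memLp_top u).toLp _‖ ≤ _
    rw [Lp.norm_toLp]
    refine ENNReal.toReal_le_of_le_ofReal (norm_nonneg _) ?_
    rw [eLpNorm_exponent_top]
    exact eLpNormEssSup_le_of_ae_bound (H1R.ae_abs_le u)

theorem coeFn_supL (u : H1R) : supL u =ᵐ[volume] valL u := MemLp.coeFn_toLp (H1R.memLp_top u)

theorem norm_supL_le (u : H1R) : ‖supL u‖ ≤ ‖u‖ := by
  simpa using (supL.le_of_opNorm_le (LinearMap.mkContinuous_norm_le _ zero_le_one _) u)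

theorem mulL_supL_comm (u u' : H1R) : mulL (supL u) (valL u') = mulL (supL u') (valL u) := by
  refine Lp.ext ?_
  filter_upwards [coeFn_mulL (supL u) (valL u'), coeFn_mulL (supL u') (valL u), coeFn_supL u,
    coeFn_supL u'] with x h1 h2 h3 h4
  rw [h1, h2, h3, h4, mul_comm]

/-- The square of an element of `H¹(ℝ)`. -/
def sqH1 (u : H1R) : L2R := mulL (supL u) (valL u)

/-- The derivative of the square of an element of `H¹(ℝ)`. -/
def sqDx (u : H1R) : L2R := (2 : ℝ) • mulL (supL u) (dxL u)

theorem hasWeakDeriv_sqH1 (u : H1R) : HasWeakDeriv (sqH1 u) (sqDx u) := by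
  obtain ⟨P, hP, hae, -⟩ := (H1R.exists_isPrimitive u)
  refine (hP.mul hP).hasWeakDeriv ?_ ?_
  · filter_upwards [coeFn_mulL (supL u) (valL u), coeFn_supL u, hae] with x h1 h2 h3
    rw [sqH1, h1, h2, h3]
  · filter_upwards [coeFn_mulL (supL u) (dxL u), coeFn_supL u, hae,
      Lp.coeFn_smul (2 : ℝ) (mulL (supL u) (dxL u))] with x h1 h2 h3 h4
    rw [sqDx, h4, Pi.smul_apply, h1, h2, h3, smul_eq_mul]
    ring

/-! ### Integration by parts with Lipschitz weights -/

/-- The bounded weight `a` is Lipschitz with derivative `b`. -/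
def HasWeightDeriv (a b : Lp ℝ ⊤ (volume : Measure ℝ)) : Prop :=
  ∃ A, IsPrimitive A b ∧ a =ᵐ[volume] A

/-- Integration by parts on the line with a Lipschitz weight. -/
theorem HasWeightDeriv.inner_add_inner {a b : Lp ℝ ⊤ (volume : Measure ℝ)}
    (hab : HasWeightDeriv a b) {f f' g g' : L2R} (hf : HasWeakDeriv f f') (hg : HasWeakDeriv g g') :
    inner ℝ (mulL a f) g' + inner ℝ (mulL a f') g + inner ℝ (mulL b f) g = 0 := by
  obtain ⟨A, hA, hAe⟩ := hab
  obtain ⟨P, hP, hPe⟩ := hf.exists_isPrimitive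
  obtain ⟨Q, hQ, hQe⟩ := hg.exists_isPrimitive
  have i1 := integrable_mulL a f g'
  have i2 := integrable_mulL a f' g
  have i3 := integrable_mulL b f g
  have e : (fun x => a x * f x * g' x + a x * f' x * g x + b x * f x * g x) =ᵐ[volume]
      fun x => (b x * P x + A x * f' x) * Q x + A x * P x * g' x := by
    filter_upwards [hAe, hPe, hQe] with x h1 h2 h3
    rw [h1, h2, h3]
    ring
  have i0 : Integrable fun x => A x * P x * Q x := by
    refine (integrable_mulL a f g).congr ?_
    filter_upwards [hAe, hPe, hQe] with x h1 h2 h3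
    rw [h1, h2, h3]
  rw [inner_mulL, inner_mulL, inner_mulL, ← integral_add i1 i2,
    ← integral_add (f := fun x => a x * f x * g' x + a x * f' x * g x) (i1.add i2) i3,
    ← ((hA.mul hP).mul hQ).integral_eq_zero i0 (((i1.add i2).add i3).congr e)]
  exact integral_congr_ae e

theorem HasWeightDeriv.two_inner {a b : Lp ℝ ⊤ (volume : Measure ℝ)}
    (hab : HasWeightDeriv a b) {f f' : L2R} (hf : HasWeakDeriv f f') :
    2 * inner ℝ (mulL a f) f' = - inner ℝ (mulL b f) f := by
  have := hab.inner_add_inner hf hf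
  rw [inner_mulL_comm a f' f] at this
  linarith

theorem HasWeakDeriv.inner_add_inner {f f' g g' : L2R} (hf : HasWeakDeriv f f')
    (hg : HasWeakDeriv g g') : inner ℝ f g' + inner ℝ f' g = 0 := by
  obtain ⟨P, hP, hPe⟩ := hf.exists_isPrimitive
  obtain ⟨Q, hQ, hQe⟩ := hg.exists_isPrimitive
  have i1 := L2R.integrable_mul f g'
  have i2 := L2R.integrable_mul f' g
  have e : (fun x => f x * g' x + f' x * g x) =ᵐ[volume] fun x => f' x * Q x + P x * g' x := by
    filter_upwards [hPe, hQe] with x h2 h3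
    rw [h2, h3]
    ring
  have i0 : Integrable fun x => P x * Q x := by
    refine (L2R.integrable_mul f g).congr ?_
    filter_upwards [hPe, hQe] with x h2 h3
    rw [h2, h3]
  rw [L2R.inner_eq_integral, L2R.inner_eq_integral, ← integral_add i1 i2,
    ← (hP.mul hQ).integral_eq_zero i0 ((i1.add i2).congr e)]
  exact integral_congr_ae e

/-! ### The regularized equations -/

/-- A solution of the Klein-Gordon-Zakharov system extended continuously to negative times. -/
structure IsKGZCurve (u : ℝ → H1R) (w n v : ℝ → L2R) : Prop extends IsKGZSolution u w n v where
  continuous_u : Continuous u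
  continuous_w : Continuous w
  continuous_n : Continuous n
  continuous_v : Continuous v

theorem IsKGZSolution.isKGZCurve {u : ℝ → H1R} {w n v : ℝ → L2R} (h : IsKGZSolution u w n v) :
    IsKGZCurve (fun t => u (max t 0)) (fun t => w (max t 0)) (fun t => n (max t 0))
      (fun t => v (max t 0)) := by
  have hc : ∀ {E : Type} [TopologicalSpace E] {f : ℝ → E}, ContinuousOn f (Ici 0) →
      Continuous fun t => f (max t 0) := fun hf =>
    hf.comp_continuous (by fun_prop) fun t => mem_Ici.2 (le_max_right _ _)
  refine ⟨⟨(hc h.continuousOn_u).continuousOn, (hc h.continuousOn_w).continuousOn,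
    (hc h.continuousOn_n).continuousOn, (hc h.continuousOn_v).continuousOn, ?_, ?_, ?_, ?_⟩,
    hc h.continuousOn_u, hc h.continuousOn_w, hc h.continuousOn_n, hc h.continuousOn_v⟩
  all_goals
    intro ψ hψ t ht
    simp only [max_eq_left ht]
  · exact (h.eq_u ψ hψ t ht).congr (fun s hs => by simp only [max_eq_left (mem_Ici.1 hs)])
      (by simp only [max_eq_left ht])
  · exact (h.eq_w ψ hψ t ht).congr (fun s hs => by simp only [max_eq_left (mem_Ici.1 hs)])
      (by simp only [max_eq_left ht])
  · exact (h.eq_n ψ hψ t ht).congr (fun s hs => by simp only [max_eq_left (mem_Ici.1 hs)])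
      (by simp only [max_eq_left ht])
  · exact (h.eq_v ψ hψ t ht).congr (fun s hs => by simp only [max_eq_left (mem_Ici.1 hs)])
      (by simp only [max_eq_left ht])

@[fun_prop]
theorem Continuous.steklovAverage {X : Type*} [TopologicalSpace X] {a : X → ℝ} {f : X → L2R}
    (ha : Continuous a) (hf : Continuous f) : Continuous fun x => steklov (a x) (f x) := by
  have := continuous_steklov.comp (ha.prodMk hf)
  exact this

@[fun_prop]
theorem continuous_sqH1 : Continuous sqH1 := by unfold sqH1; fun_prop

@[fun_prop]
theorem continuous_sqDx : Continuous sqDx := by unfold sqDx; fun_prop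

namespace IsKGZCurve

variable {u : ℝ → H1R} {w n v : ℝ → L2R}

theorem hasDeriv_val (H : IsKGZCurve u w n v) {t : ℝ} (ht : 0 ≤ t) :
    HasDerivWithinAt (fun s => valL (u s)) (w t) (Ici 0) t :=
  hasDerivWithinAt_of_test (valL.continuous.comp H.continuous_u) H.continuous_w H.eq_u t ht

/-- The slope of u² factors as (u(s) + u(t)) times the slope of u. The first factor converges in L^∞
by the Sobolev embedding and the second in L². -/
theorem hasDeriv_sqH1 (H : IsKGZCurve u w n v) {t : ℝ} (ht : 0 ≤ t) :
    HasDerivWithinAt (fun s => sqH1 (u s)) ((2 : ℝ) • mulL (supL (u t)) (w t)) (Ici 0) t := by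
  have h1 := hasDerivWithinAt_iff_tendsto_slope.1 (H.hasDeriv_val ht)
  rw [hasDerivWithinAt_iff_tendsto_slope]
  have hc : Tendsto (fun s => mulL (supL (u s + u t))) (𝓝[Ici 0 \ {t}] t)
      (𝓝 (mulL (supL (u t + u t)))) :=
    (Continuous.tendsto (by have := H.continuous_u; fun_prop) t).mono_left nhdsWithin_le_nhds
  have hlim := (isBoundedBilinearMap_apply.continuous.tendsto
    (mulL (supL (u t + u t)), w t)).comp (hc.prodMk_nhds h1)
  have e : mulL (supL (u t + u t)) (w t) = (2 : ℝ) • mulL (supL (u t)) (w t) := by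
    simp [two_smul]
  simp only [e] at hlim
  refine hlim.congr fun s => ?_
  change mulL (supL (u s + u t)) (slope (fun s => valL (u s)) t s) = _
  rw [slope_def_module, slope_def_module, map_smul, ← map_sub valL]
  congr 1
  simp only [map_add, map_sub, _root_.add_apply, sqH1, mulL_supL_comm (u s) (u t)]
  abel

theorem hasDeriv_diffQuot_val (H : IsKGZCurve u w n v) (a : ℝ) {t : ℝ} (ht : 0 ≤ t) :
    HasDerivWithinAt (fun s => diffQuot a (valL (u s))) (diffQuot a (w t)) (Ici 0) t :=
  (diffQuot a).hasFDerivAt.comp_hasDerivWithinAt t (H.hasDeriv_val ht)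

theorem hasDeriv_steklov_val (H : IsKGZCurve u w n v) {a : ℝ} (ha : a ≠ 0) {t : ℝ} (ht : 0 ≤ t) :
    HasDerivWithinAt (fun s => steklov a (valL (u s))) (steklov a (w t)) (Ici 0) t := by
  refine hasDerivWithinAt_of_test (X := fun s => steklov a (valL (u s)))
    (Y := fun s => steklov a (w s))
    (continuous_const.steklovAverage (valL.continuous.comp H.continuous_u))
    (continuous_const.steklovAverage H.continuous_w) (fun ψ hψ t ht => ?_) t ht
  simp only [integral_steklov_mul a _ hψ]
  exact H.eq_u _ (hψ.testAverage ha) t ht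

theorem hasDeriv_steklov_dx (H : IsKGZCurve u w n v) {a : ℝ} (ha : a ≠ 0) {t : ℝ} (ht : 0 ≤ t) :
    HasDerivWithinAt (fun s => steklov a (dxL (u s))) (diffQuot a (w t)) (Ici 0) t := by
  simp only [(hasWeakDeriv_valL _).steklov_eq ha]
  exact H.hasDeriv_diffQuot_val a ht

theorem hasDeriv_steklov_n (H : IsKGZCurve u w n v) {a : ℝ} (ha : a ≠ 0) {t : ℝ} (ht : 0 ≤ t) :
    HasDerivWithinAt (fun s => steklov a (n s)) (-diffQuot a (v t)) (Ici 0) t := by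
  refine hasDerivWithinAt_of_test (X := fun s => steklov a (n s))
    (Y := fun s => -diffQuot a (v s))
    (continuous_const.steklovAverage H.continuous_n)
    (by have := H.continuous_v; fun_prop) (fun ψ hψ t ht => ?_) t ht
  simp only [integral_steklov_mul a _ hψ]
  convert! H.eq_n _ (hψ.testAverage ha) t ht using 1
  rw [integral_mul_deriv_testAverage ha _ hψ, ← hψ.inner_toL2, inner_neg_right, hψ.inner_toL2]

theorem hasDeriv_steklov_v (H : IsKGZCurve u w n v) {a : ℝ} (ha : a ≠ 0) {t : ℝ} (ht : 0 ≤ t) :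
    HasDerivWithinAt (fun s => steklov a (v s))
      (-diffQuot a (n t) - steklov a (sqDx (u t))) (Ici 0) t := by
  refine hasDerivWithinAt_of_test (X := fun s => steklov a (v s))
    (Y := fun s => -diffQuot a (n s) - steklov a (sqDx (u s)))
    (continuous_const.steklovAverage H.continuous_v)
    (((diffQuot a).continuous.comp H.continuous_n).neg.sub
      (continuous_const.steklovAverage (continuous_sqDx.comp H.continuous_u))) (fun ψ hψ t ht => ?_) t ht
  have hχ := hψ.testAverage ha
  simp only [integral_steklov_mul a _ hψ]
  convert! H.eq_v _ hχ t ht using 1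
  have e : ∫ x, (n t x + l2Val (u t) x ^ 2) * deriv (testAverage a ψ) x =
      (∫ x, n t x * deriv (testAverage a ψ) x)
        + ∫ x, sqH1 (u t) x * deriv (testAverage a ψ) x := by
    rw [← integral_add (hχ.deriv.integrable_mul _) (hχ.deriv.integrable_mul _)]
    refine integral_congr_ae ?_
    filter_upwards [coeFn_mulL (supL (u t)) (valL (u t)), coeFn_supL (u t)] with x h1 h2
    rw [sqH1, h1, h2]
    change (n t x + valL (u t) x ^ 2) * _ = _
    ring
  rw [e, integral_mul_deriv_testAverage ha _ hψ, hasWeakDeriv_sqH1 (u t) _ hχ,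
    ← integral_steklov_mul a _ hψ, ← hψ.inner_toL2, inner_sub_right, inner_neg_right,
    hψ.inner_toL2, hψ.inner_toL2]
  ring

theorem hasDeriv_steklov_w (H : IsKGZCurve u w n v) {a : ℝ} (ha : a ≠ 0) {t : ℝ} (ht : 0 ≤ t) :
    HasDerivWithinAt (fun s => steklov a (w s))
      (diffQuot a (dxL (u t)) - steklov a (valL (u t)) - steklov a (mulL (supL (u t)) (n t)))
      (Ici 0) t := by
  have hu := H.continuous_u
  have hn := H.continuous_n
  refine hasDerivWithinAt_of_test (X := fun s => steklov a (w s))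
    (Y := fun s => diffQuot a (dxL (u s)) - steklov a (valL (u s))
      - steklov a (mulL (supL (u s)) (n s)))
    (continuous_const.steklovAverage H.continuous_w)
    (((by fun_prop : Continuous fun s => diffQuot a (dxL (u s))).sub
      (continuous_const.steklovAverage (by fun_prop))).sub (continuous_const.steklovAverage (by fun_prop)))
    (fun ψ hψ t ht => ?_) t ht
  have hχ := hψ.testAverage ha
  simp only [integral_steklov_mul a (w _) hψ]
  convert! H.eq_w _ hχ t ht using 1
  have e : ∫ x, n t x * l2Val (u t) x * testAverage a ψ x =
      ∫ x, mulL (supL (u t)) (n t) x * testAverage a ψ x := by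
    refine integral_congr_ae ?_
    filter_upwards [coeFn_mulL (supL (u t)) (n t), coeFn_supL (u t)] with x h1 h2
    rw [h1, h2]
    change n t x * valL (u t) x * _ = _
    ring
  rw [e, ← hψ.inner_toL2, inner_sub_right, inner_sub_right,
    hψ.inner_toL2, hψ.inner_toL2, hψ.inner_toL2, integral_steklov_mul a (valL (u t)) hψ]
  have e2 := hasWeakDeriv_valL (u t) _ hχ.deriv
  rw [integral_mul_deriv_testAverage ha _ hψ, neg_neg] at e2
  rw [← e2, integral_steklov_mul a (mulL _ _) hψ]
  rfl

end IsKGZCurve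

/-! ### Energy and virial identities -/

theorem hasDerivWithinAt_inner_mulL {X Y : ℝ → L2R} {X' Y' : L2R} {s : Set ℝ} {t : ℝ}
    (hX : HasDerivWithinAt X X' s t) (hY : HasDerivWithinAt Y Y' s t)
    (a : Lp ℝ ⊤ (volume : Measure ℝ)) :
    HasDerivWithinAt (fun s => inner ℝ (mulL a (X s)) (Y s))
      (inner ℝ (mulL a (X t)) Y' + inner ℝ (mulL a X') (Y t)) s t :=
  ((mulL a).hasFDerivAt.comp_hasDerivWithinAt t hX).inner ℝ hY

namespace IsKGZCurve

variable {u : ℝ → H1R} {w n v : ℝ → L2R} {a b c : Lp ℝ ⊤ (volume : Measure ℝ)}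

/-- Conservation of the energy. -/
theorem hasDeriv_energy (H : IsKGZCurve u w n v) {t : ℝ} (ht : 0 ≤ t) :
    HasDerivWithinAt (fun s => ‖u s‖ ^ 2 + ‖w s‖ ^ 2 + (1 / 2) * ‖n s‖ ^ 2 + (1 / 2) * ‖v s‖ ^ 2
      + inner ℝ (n s) (sqH1 (u s))) 0 (Ici 0) t := by
  have hu := H.continuous_u
  have hw := H.continuous_w
  have hn := H.continuous_n
  have hv := H.continuous_v
  -- Only `n` is averaged in the cubic term: u² is already in H¹ and differentiable in L². In `r`
  -- the difference quotients have been integrated by parts away, and what remains cancels at h = 0.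
  let m : ℝ → ℝ → ℝ := fun h s =>
    inner ℝ (steklov h (valL (u s))) (steklov h (valL (u s)))
    + inner ℝ (steklov h (dxL (u s))) (steklov h (dxL (u s)))
    + inner ℝ (steklov h (w s)) (steklov h (w s))
    + (1 / 2) * inner ℝ (steklov h (n s)) (steklov h (n s))
    + (1 / 2) * inner ℝ (steklov h (v s)) (steklov h (v s))
    + inner ℝ (steklov h (n s)) (sqH1 (u s))
  let r : ℝ → ℝ → ℝ := fun h s =>
    -2 * inner ℝ (steklov h (w s)) (steklov h (mulL (supL (u s)) (n s)))
    - inner ℝ (steklov h (v s)) (steklov h (sqDx (u s)))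
    + inner ℝ (steklov h (v s)) (sqDx (u s))
    + 2 * inner ℝ (steklov h (n s)) (mulL (supL (u s)) (w s))
  have key := hasDerivWithinAt_of_continuous_family (m := m) (r := r)
    (by fun_prop) (by fun_prop) (fun h hh t ht => by
      have dU := H.hasDeriv_steklov_val hh ht
      have dP := H.hasDeriv_steklov_dx hh ht
      have dW := H.hasDeriv_steklov_w hh ht
      have dN := H.hasDeriv_steklov_n hh ht
      have dV := H.hasDeriv_steklov_v hh ht
      have dQ := H.hasDeriv_sqH1 ht
      have i1 := (hasWeakDeriv_steklov hh (w t)).inner_add_inner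
        (hasWeakDeriv_steklov hh (dxL (u t)))
      have i2 := (hasWeakDeriv_steklov hh (n t)).inner_add_inner (hasWeakDeriv_steklov hh (v t))
      have i3 := (hasWeakDeriv_steklov hh (v t)).inner_add_inner (hasWeakDeriv_sqH1 (u t))
      convert! (((((dU.inner ℝ dU).add (dP.inner ℝ dP)).add (dW.inner ℝ dW)).add
        ((dN.inner ℝ dN).const_mul (1 / 2))).add ((dV.inner ℝ dV).const_mul (1 / 2))).add
        (dN.inner ℝ dQ) using 1
      simp only [r, inner_sub_left, inner_sub_right, inner_neg_left, inner_neg_right,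
        inner_smul_right]
      have C : ∀ x y : L2R, inner ℝ x y = inner ℝ y x := fun x y => real_inner_comm y x
      linarith [C (steklov h (w t)) (steklov h (valL (u t))),
        C (diffQuot h (w t)) (steklov h (dxL (u t))),
        C (steklov h (w t)) (diffQuot h (dxL (u t))),
        C (steklov h (w t)) (steklov h (mulL (supL (u t)) (n t))),
        C (steklov h (n t)) (diffQuot h (v t)), C (steklov h (v t)) (diffQuot h (n t)),
        C (steklov h (v t)) (steklov h (sqDx (u t)))]) t ht
  have e1 : m 0 = fun s => ‖u s‖ ^ 2 + ‖w s‖ ^ 2 + (1 / 2) * ‖n s‖ ^ 2 + (1 / 2) * ‖v s‖ ^ 2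
      + inner ℝ (n s) (sqH1 (u s)) := by
    ext s
    simp only [m, steklov_zero, real_inner_self_eq_norm_sq, H1R.norm_sq_eq]
  have e2 : r 0 t = 0 := by
    simp only [r, steklov_zero, inner_mulL_right, inner_mulL_comm _ (w t) (n t)]
    ring
  rwa [e1, e2] at key

/-- The identity for the energy with a weight, without its cubic part. -/
theorem hasDeriv_weightedEnergy (H : IsKGZCurve u w n v) (hab : HasWeightDeriv a b) {t : ℝ}
    (ht : 0 ≤ t) :
    HasDerivWithinAt (fun s => inner ℝ (mulL a (valL (u s))) (valL (u s))
      + inner ℝ (mulL a (dxL (u s))) (dxL (u s)) + inner ℝ (mulL a (w s)) (w s)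
      + (1 / 2) * inner ℝ (mulL a (n s)) (n s) + (1 / 2) * inner ℝ (mulL a (v s)) (v s))
      (-2 * inner ℝ (mulL b (dxL (u t))) (w t)
        - 2 * inner ℝ (mulL a (w t)) (mulL (supL (u t)) (n t))
        + inner ℝ (mulL b (n t)) (v t) - inner ℝ (mulL a (v t)) (sqDx (u t))) (Ici 0) t := by
  have hu := H.continuous_u
  have hw := H.continuous_w
  have hn := H.continuous_n
  have hv := H.continuous_v
  let m : ℝ → ℝ → ℝ := fun h s =>
    inner ℝ (mulL a (steklov h (valL (u s)))) (steklov h (valL (u s)))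
    + inner ℝ (mulL a (steklov h (dxL (u s)))) (steklov h (dxL (u s)))
    + inner ℝ (mulL a (steklov h (w s))) (steklov h (w s))
    + (1 / 2) * inner ℝ (mulL a (steklov h (n s))) (steklov h (n s))
    + (1 / 2) * inner ℝ (mulL a (steklov h (v s))) (steklov h (v s))
  let r : ℝ → ℝ → ℝ := fun h s =>
    -2 * inner ℝ (mulL b (steklov h (dxL (u s)))) (steklov h (w s))
    - 2 * inner ℝ (mulL a (steklov h (w s))) (steklov h (mulL (supL (u s)) (n s)))
    + inner ℝ (mulL b (steklov h (n s))) (steklov h (v s))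
    - inner ℝ (mulL a (steklov h (v s))) (steklov h (sqDx (u s)))
  have key := hasDerivWithinAt_of_continuous_family (m := m) (r := r)
    (by fun_prop) (by fun_prop) (fun h hh t ht => by
      have dU := H.hasDeriv_steklov_val hh ht
      have dP := H.hasDeriv_steklov_dx hh ht
      have dW := H.hasDeriv_steklov_w hh ht
      have dN := H.hasDeriv_steklov_n hh ht
      have dV := H.hasDeriv_steklov_v hh ht
      have i1 := hab.inner_add_inner (hasWeakDeriv_steklov hh (dxL (u t)))
        (hasWeakDeriv_steklov hh (w t))
      have i2 := hab.inner_add_inner (hasWeakDeriv_steklov hh (n t)) (hasWeakDeriv_steklov hh (v t))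
      convert! ((((hasDerivWithinAt_inner_mulL dU dU a).add
        (hasDerivWithinAt_inner_mulL dP dP a)).add (hasDerivWithinAt_inner_mulL dW dW a)).add
        ((hasDerivWithinAt_inner_mulL dN dN a).const_mul (1 / 2))).add
        ((hasDerivWithinAt_inner_mulL dV dV a).const_mul (1 / 2)) using 1
      simp only [r, map_sub, map_neg, inner_sub_left, inner_sub_right, inner_neg_left,
        inner_neg_right]
      linarith [inner_mulL_comm a (steklov h (w t)) (steklov h (valL (u t))),
        inner_mulL_comm a (diffQuot h (w t)) (steklov h (dxL (u t))),
        inner_mulL_comm a (steklov h (w t)) (diffQuot h (dxL (u t))),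
        inner_mulL_comm a (steklov h (w t)) (steklov h (mulL (supL (u t)) (n t))),
        inner_mulL_comm a (steklov h (n t)) (diffQuot h (v t)),
        inner_mulL_comm a (steklov h (v t)) (diffQuot h (n t)),
        inner_mulL_comm a (steklov h (v t)) (steklov h (sqDx (u t)))]) t ht
  simpa only [m, r, steklov_zero] using key

/-- The virial identity for the localized momentum. -/
theorem hasDeriv_virial (H : IsKGZCurve u w n v) (hab : HasWeightDeriv a b)
    (hbc : HasWeightDeriv b c) {t : ℝ} (ht : 0 ≤ t) :
    HasDerivWithinAt (fun s => 2 * inner ℝ (mulL a (dxL (u s))) (w s)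
      + inner ℝ (mulL b (valL (u s))) (w s) - inner ℝ (mulL a (n s)) (v s))
      (-2 * inner ℝ (mulL b (dxL (u t))) (dxL (u t)) - inner ℝ (mulL c (valL (u t))) (dxL (u t))
        - inner ℝ (mulL b (valL (u t))) (mulL (supL (u t)) (n t))
        - (1 / 2) * inner ℝ (mulL b (n t)) (n t)
        - (1 / 2) * inner ℝ (mulL b (v t)) (v t)) (Ici 0) t := by
  have hu := H.continuous_u
  have hw := H.continuous_w
  have hn := H.continuous_n
  have hv := H.continuous_v
  let m : ℝ → ℝ → ℝ := fun h s =>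
    2 * inner ℝ (mulL a (steklov h (dxL (u s)))) (steklov h (w s))
    + inner ℝ (mulL b (steklov h (valL (u s)))) (steklov h (w s))
    - inner ℝ (mulL a (steklov h (n s))) (steklov h (v s))
  let r : ℝ → ℝ → ℝ := fun h s =>
    -2 * inner ℝ (mulL b (steklov h (dxL (u s)))) (steklov h (dxL (u s)))
    - inner ℝ (mulL c (steklov h (valL (u s)))) (steklov h (dxL (u s)))
    - inner ℝ (mulL b (steklov h (valL (u s)))) (steklov h (mulL (supL (u s)) (n s)))
    - (1 / 2) * inner ℝ (mulL b (steklov h (n s))) (steklov h (n s))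
    - (1 / 2) * inner ℝ (mulL b (steklov h (v s))) (steklov h (v s))
    + (inner ℝ (mulL a (steklov h (n s))) (steklov h (sqDx (u s)))
      - 2 * inner ℝ (mulL a (steklov h (dxL (u s)))) (steklov h (mulL (supL (u s)) (n s))))
  have key := hasDerivWithinAt_of_continuous_family (m := m) (r := r)
    (by fun_prop) (by fun_prop) (fun h hh t ht => by
      have dU := H.hasDeriv_steklov_val hh ht
      have dP := H.hasDeriv_steklov_dx hh ht
      have dW := H.hasDeriv_steklov_w hh ht
      have dN := H.hasDeriv_steklov_n hh ht
      have dV := H.hasDeriv_steklov_v hh ht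
      have wU := hasWeakDeriv_steklov hh (valL (u t))
      rw [← (hasWeakDeriv_valL (u t)).steklov_eq hh] at wU
      have i1 := hab.two_inner (hasWeakDeriv_steklov hh (dxL (u t)))
      have i2 := hab.two_inner (hasWeakDeriv_steklov hh (w t))
      have i3 := hab.two_inner (hasWeakDeriv_steklov hh (n t))
      have i4 := hab.two_inner (hasWeakDeriv_steklov hh (v t))
      have i5 := hab.two_inner wU
      -- The term in u u_xx is integrated by parts only once: `c` has a jump at 0 for the weights
      -- used later, so it is not differentiated again.
      have i6 := hbc.inner_add_inner wU (hasWeakDeriv_steklov hh (dxL (u t)))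
      convert! (((hasDerivWithinAt_inner_mulL dP dW a).const_mul 2).add
        (hasDerivWithinAt_inner_mulL dU dW b)).sub (hasDerivWithinAt_inner_mulL dN dV a) using 1
      simp only [r, map_neg, inner_sub_right, inner_neg_left, inner_neg_right]
      linarith [inner_mulL_comm a (diffQuot h (w t)) (steklov h (w t)),
        inner_mulL_comm a (steklov h (dxL (u t))) (steklov h (valL (u t))),
        inner_mulL_comm a (diffQuot h (v t)) (steklov h (v t))]) t ht
  -- The contributions of φ n (u²)_x and 2φ u_x u n cancel exactly once the averages are removed;
  -- this is the reason for the factor 2 in the momentum.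
  have e : inner ℝ (mulL a (n t)) (sqDx (u t))
      - 2 * inner ℝ (mulL a (dxL (u t))) (mulL (supL (u t)) (n t)) = 0 := by
    rw [sqDx, inner_smul_right, inner_mulL_right, inner_mulL_right, inner_mulL, inner_mulL,
      sub_eq_zero]
    congr 1
    refine integral_congr_ae ?_
    filter_upwards [coeFn_mulL a (n t), coeFn_mulL a (dxL (u t))] with x h1 h2
    rw [h1, h2]
    ring
  simpa only [m, r, steklov_zero, e, add_zero] using key

/-- The identity for the localized product of `u` and `u_t`. -/
theorem hasDeriv_inner_val_w (H : IsKGZCurve u w n v) (hab : HasWeightDeriv a b) {t : ℝ}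
    (ht : 0 ≤ t) :
    HasDerivWithinAt (fun s => inner ℝ (mulL a (valL (u s))) (w s))
      (inner ℝ (mulL a (w t)) (w t) - inner ℝ (mulL a (dxL (u t))) (dxL (u t))
        - inner ℝ (mulL b (valL (u t))) (dxL (u t)) - inner ℝ (mulL a (valL (u t))) (valL (u t))
        - inner ℝ (mulL a (valL (u t))) (mulL (supL (u t)) (n t))) (Ici 0) t := by
  have hu := H.continuous_u
  have hw := H.continuous_w
  have hn := H.continuous_n
  let m : ℝ → ℝ → ℝ := fun h s =>
    inner ℝ (mulL a (steklov h (valL (u s)))) (steklov h (w s))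
  let r : ℝ → ℝ → ℝ := fun h s =>
    inner ℝ (mulL a (steklov h (w s))) (steklov h (w s))
    - inner ℝ (mulL a (steklov h (dxL (u s)))) (steklov h (dxL (u s)))
    - inner ℝ (mulL b (steklov h (valL (u s)))) (steklov h (dxL (u s)))
    - inner ℝ (mulL a (steklov h (valL (u s)))) (steklov h (valL (u s)))
    - inner ℝ (mulL a (steklov h (valL (u s)))) (steklov h (mulL (supL (u s)) (n s)))
  have key := hasDerivWithinAt_of_continuous_family (m := m) (r := r)
    (by fun_prop) (by fun_prop) (fun h hh t ht => by
      have dU := H.hasDeriv_steklov_val hh ht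
      have dW := H.hasDeriv_steklov_w hh ht
      have wU := hasWeakDeriv_steklov hh (valL (u t))
      rw [← (hasWeakDeriv_valL (u t)).steklov_eq hh] at wU
      have i6 := hab.inner_add_inner wU (hasWeakDeriv_steklov hh (dxL (u t)))
      convert! hasDerivWithinAt_inner_mulL dU dW a using 1
      simp only [r, inner_sub_right]
      linarith) t ht
  simpa only [m, r, steklov_zero] using key

end IsKGZCurve

/-! ### The exponential weights -/

theorem abs_exp_neg_abs_le (k : ℕ) (x : ℝ) : |Real.exp (-(k * |x|))| ≤ 1 := by
  rw [abs_of_pos (Real.exp_pos _), Real.exp_le_one_iff]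
  have : 0 ≤ (k : ℝ) * |x| := by positivity
  linarith

/-- The weight `e^{-k|x|}`. -/
def expW (k : ℕ) : Lp ℝ ⊤ (volume : Measure ℝ) :=
  (memLp_top_of_bound (f := fun x => Real.exp (-((k : ℝ) * |x|)))
    (by fun_prop) 1 (ae_of_all _ (abs_exp_neg_abs_le k))).toLp _

/-- The derivative of the weight `e^{-k|x|}`. -/
def dexpW (k : ℕ) : Lp ℝ ⊤ (volume : Measure ℝ) :=
  (memLp_top_of_bound (f := fun x => -((k : ℝ) * (sgn x * Real.exp (-((k : ℝ) * |x|)))))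
    (((measurable_sgn.mul (by fun_prop)).const_mul _).neg.aestronglyMeasurable) k
    (ae_of_all _ fun x => by
      rw [norm_neg, norm_mul, norm_mul, Real.norm_natCast, Real.norm_eq_abs, abs_sgn, one_mul]
      exact mul_le_of_le_one_right (by positivity) (abs_exp_neg_abs_le k x))).toLp _

/-- The weight `sgn(x) (1 - e^{-|x|})`. -/
def phiW : Lp ℝ ⊤ (volume : Measure ℝ) :=
  (memLp_top_of_bound (f := fun x => sgn x * (1 - Real.exp (-(((1 : ℕ) : ℝ) * |x|))))
    ((measurable_sgn.mul (by fun_prop)).aestronglyMeasurable) 2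
    (ae_of_all _ fun x => by
      rw [norm_mul, Real.norm_eq_abs, abs_sgn, one_mul]
      have := abs_exp_neg_abs_le 1 x
      refine (norm_sub_le _ _).trans ?_
      rw [norm_one, Real.norm_eq_abs]
      linarith)).toLp _

theorem coeFn_expW (k : ℕ) : expW k =ᵐ[volume] fun x => Real.exp (-((k : ℝ) * |x|)) :=
  MemLp.coeFn_toLp _

theorem coeFn_dexpW (k : ℕ) :
    dexpW k =ᵐ[volume] fun x => -((k : ℝ) * (sgn x * Real.exp (-((k : ℝ) * |x|)))) :=
  MemLp.coeFn_toLp _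

theorem hasWeightDeriv_expW (k : ℕ) : HasWeightDeriv (expW k) (dexpW k) :=
  ⟨_, (isPrimitive_exp_neg_abs k).congr (coeFn_dexpW k).symm, coeFn_expW k⟩

theorem hasWeightDeriv_phiW : HasWeightDeriv phiW (expW 1) := by
  have h1 := isPrimitive_exp_neg_abs ((1 : ℕ) : ℝ)
  have hc : Continuous fun x : ℝ => Real.exp (-(((1 : ℕ) : ℝ) * |x|)) := by fun_prop
  have h2 : IsPrimitive (fun x => 1 - Real.exp (-(((1 : ℕ) : ℝ) * |x|)))
      (fun x => sgn x * Real.exp (-(((1 : ℕ) : ℝ) * |x|))) := by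
    refine ⟨fun a b => AbsolutelyContinuousOnInterval.fun_sub
      (contDiff_const.contDiffOn).absolutelyContinuousOnInterval (h1.ac a b), ?_⟩
    filter_upwards [h1.hasDerivAt] with x hx
    convert! hx.const_sub 1 using 1
    simp
  refine ⟨_, (h2.sgn_mul (LocallyIntegrable.sgn_mul hc.locallyIntegrable) (by simp)).congr ?_,
    MemLp.coeFn_toLp _⟩
  filter_upwards [coeFn_expW 1] with x hx
  rw [hx, ← mul_assoc, sgn_mul_self, one_mul]

/-! ### Oddness and coercivity -/

/-- Continuous functions that agree almost everywhere agree everywhere, so the continuous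
representative is odd at every point. -/
theorem IsOddL2.eq_zero {f : L2R} (h : IsOddL2 f) {P : ℝ → ℝ} (hP : Continuous P)
    (hf : f =ᵐ[volume] P) : P 0 = 0 := by
  have h1 : ∀ᵐ x : ℝ, f (-x) = P (-x) :=
    (Measure.measurePreserving_neg (volume : Measure ℝ)).quasiMeasurePreserving.ae hf
  have h2 : (fun x => P (-x)) =ᵐ[volume] fun x => -P x := by
    filter_upwards [h, h1, hf] with x a b c
    rw [← b, a, c]
  have h3 := congrFun ((Continuous.ae_eq_iff_eq volume (by fun_prop) (by fun_prop)).1 h2) 0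
  simp only [neg_zero] at h3
  linarith

theorem Integrable.bdd_weight_mul {f k : ℝ → ℝ} (hf : Integrable f) (hk : Measurable k) (C : ℝ)
    (hC : ∀ x, |k x| ≤ C) : Integrable fun x => k x * f x :=
  hf.bdd_mul hk.aestronglyMeasurable (ae_of_all _ hC)

/-- Coercivity of the virial form on odd functions. -/
theorem IsOddL2.exists_coercive {u : H1R} (h : IsOddL2 (valL u)) :
    ∃ W : ℝ, 0 ≤ W ∧
      2 * inner ℝ (mulL (expW 1) (dxL u)) (dxL u)
        + inner ℝ (mulL (dexpW 1) (valL u)) (dxL u) = 2 * W ∧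
      inner ℝ (mulL (expW 1) (sqH1 u)) (sqH1 u) ≤ 16 * ‖u‖ ^ 2 * W ∧
      inner ℝ (mulL (expW 2) (valL u)) (valL u) ≤ 4 * W ∧
      inner ℝ (mulL (expW 2) (dxL u)) (dxL u) ≤ 4 * W := by
  obtain ⟨P, hP, hae, hb⟩ := H1R.exists_isPrimitive u
  have hP0 := h.eq_zero hP.continuous hae
  have hPc := hP.continuous
  have hsP := hP.sgn_mul (L2R.locallyIntegrable _) hP0
  set g : ℝ → ℝ := ((dxL u : L2R) : ℝ → ℝ) with hg
  set M := ‖u‖ with hM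
  have hM0 : 0 ≤ M := norm_nonneg u
  let ρ : ℝ → ℝ := fun x => Real.exp (-(((1 : ℕ) : ℝ) * |x|))
  let σ : ℝ → ℝ := fun x => Real.exp (-(((2 : ℕ) : ℝ) * |x|))
  have hρ0 : ∀ x, 0 < ρ x := fun x => Real.exp_pos _
  have hσ0 : ∀ x, 0 < σ x := fun x => Real.exp_pos _
  have hσρ : ∀ x, σ x ≤ ρ x := fun x => by
    refine Real.exp_le_exp.2 ?_
    push_cast
    linarith [abs_nonneg x]
  have hρ1 : ∀ x, |ρ x| ≤ 1 := abs_exp_neg_abs_le 1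
  have hσ1 : ∀ x, |σ x| ≤ 1 := abs_exp_neg_abs_le 2
  have mρ : Measurable ρ := by fun_prop
  have mσ : Measurable σ := by fun_prop
  have iPP : Integrable fun x => P x ^ 2 := by
    refine (L2R.integrable_mul (valL u) (valL u)).congr ?_
    filter_upwards [hae] with x hx
    rw [hx, sq]
  have iPg : Integrable fun x => P x * g x := by
    refine (L2R.integrable_mul (valL u) (dxL u)).congr ?_
    filter_upwards [hae] with x hx
    rw [hx]
  have igg : Integrable fun x => g x ^ 2 := by
    simpa only [sq] using L2R.integrable_mul (dxL u) (dxL u)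
  -- `z` is e^{|x|/2} (e^{-|x|/2} P)_x, so ∫ρz² is the square of the L² norm of (e^{-|x|/2} P)_x.
  let z : ℝ → ℝ := fun x => g x - sgn x * P x / 2
  have isPg : Integrable fun x => sgn x * (P x * g x) :=
    Integrable.bdd_weight_mul iPg measurable_sgn 1 fun x => (abs_sgn x).le
  have hs := sgn_mul_self
  have izz : Integrable fun x => z x ^ 2 := by
    refine ((igg.sub isPg).add (iPP.const_mul (1 / 4))).congr (ae_of_all _ fun x => ?_)
    simp only [Pi.add_apply, Pi.sub_apply, z]
    linear_combination (-(1 / 4) * P x ^ 2) * hs x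
  have isPz : Integrable fun x => 2 * (sgn x * P x * z x) := by
    refine ((isPg.const_mul 2).sub iPP).congr (ae_of_all _ fun x => ?_)
    simp only [Pi.sub_apply, z]
    linear_combination (P x ^ 2) * hs x
  have i4 : Integrable fun x => P x ^ 4 := by
    refine (Integrable.bdd_weight_mul iPP (k := fun x => P x ^ 2) (by fun_prop) (M ^ 2)
      fun x => ?_).congr (ae_of_all _ fun x => by ring)
    rw [abs_pow]
    exact pow_le_pow_left₀ (abs_nonneg _) (hb x) 2
  have isP3z : Integrable fun x => 4 * (sgn x * P x ^ 3 * z x) := by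
    refine ((Integrable.bdd_weight_mul isPz (k := fun x => P x ^ 2) (by fun_prop) (M ^ 2)
      fun x => ?_).const_mul 2).congr (ae_of_all _ fun x => by ring)
    rw [abs_pow]
    exact pow_le_pow_left₀ (abs_nonneg _) (hb x) 2
  have jzz : Integrable fun x => ρ x * z x ^ 2 := Integrable.bdd_weight_mul izz mρ 1 hρ1
  have jPz : Integrable fun x => ρ x * (2 * (sgn x * P x * z x)) :=
    Integrable.bdd_weight_mul isPz mρ 1 hρ1
  have j4 : Integrable fun x => ρ x * P x ^ 4 := Integrable.bdd_weight_mul i4 mρ 1 hρ1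
  have jP3z : Integrable fun x => ρ x * (4 * (sgn x * P x ^ 3 * z x) + P x ^ 4) :=
    Integrable.bdd_weight_mul (isP3z.add i4) mρ 1 hρ1
  have kPP : Integrable fun x => σ x * P x ^ 2 := Integrable.bdd_weight_mul iPP mσ 1 hσ1
  have kgg : Integrable fun x => σ x * g x ^ 2 := Integrable.bdd_weight_mul igg mσ 1 hσ1
  have kPz : Integrable fun x => σ x * (2 * (sgn x * P x * z x) - P x ^ 2) :=
    Integrable.bdd_weight_mul (isPz.sub iPP) mσ 1 hσ1
  have pρ := isPrimitive_exp_neg_abs ((1 : ℕ) : ℝ)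
  have pσ := isPrimitive_exp_neg_abs ((2 : ℕ) : ℝ)
  have iPsP : Integrable fun x => P x * (sgn x * P x) :=
    (Integrable.bdd_weight_mul iPP measurable_sgn 1 fun x => (abs_sgn x).le).congr
      (ae_of_all _ fun x => by ring)
  -- The integrand is the derivative of ρ sgn P². Its P² terms cancel, so this weight gives no
  -- control of ∫ρP²; the faster weight σ in `z3` leaves -P², which does.
  have z1 : ∫ x, ρ x * (2 * (sgn x * P x * z x)) = 0 := by
    refine ((pρ.mul (hP.mul hsP)).congr (ae_of_all _ fun x => ?_)).integral_eq_zero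
      (Integrable.bdd_weight_mul iPsP mρ 1 hρ1) jPz
    simp only [z, ρ]
    push_cast
    ring
  -- The integrand is the derivative of ρ sgn P⁴; with the fourth power a positive term ρP⁴
  -- survives.
  have z2 : ∫ x, ρ x * (4 * (sgn x * P x ^ 3 * z x) + P x ^ 4) = 0 := by
    refine ((pρ.mul (hP.mul (hP.mul (hP.mul hsP)))).congr
      (ae_of_all _ fun x => ?_)).integral_eq_zero ?_ jP3z
    · simp only [z, ρ]
      push_cast
      linear_combination (Real.exp (-(1 * |x|)) * P x ^ 4) * hs x
    · refine Integrable.bdd_weight_mul ?_ mρ 1 hρ1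
      exact (Integrable.bdd_weight_mul i4 measurable_sgn 1 fun x => (abs_sgn x).le).congr
        (ae_of_all _ fun x => by ring)
  have z3 : ∫ x, σ x * (2 * (sgn x * P x * z x) - P x ^ 2) = 0 := by
    refine ((pσ.mul (hP.mul hsP)).congr (ae_of_all _ fun x => ?_)).integral_eq_zero
      (Integrable.bdd_weight_mul iPsP mσ 1 hσ1) kPz
    simp only [z, σ]
    push_cast
    linear_combination (-Real.exp (-(2 * |x|)) * P x ^ 2) * hs x
  -- By `z3`, ∫σP² = 2∫σ sgn P z, and Young's inequality bounds this by ½∫σP² + 2∫σz².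
  have B : ∫ x, σ x * P x ^ 2 ≤ 4 * ∫ x, ρ x * z x ^ 2 := by
    have := integral_mono kPP
      ((kPz.neg.add (kPP.const_mul (1 / 2))).add (jzz.const_mul 2)) fun x => by
        simp only [Pi.add_apply, Pi.neg_apply]
        have h1 : σ x * z x ^ 2 ≤ ρ x * z x ^ 2 :=
          mul_le_mul_of_nonneg_right (hσρ x) (sq_nonneg _)
        have h2 : 0 ≤ σ x * (sgn x * P x - 2 * z x) ^ 2 := mul_nonneg (hσ0 x).le (sq_nonneg _)
        have h3 : sgn x ^ 2 = 1 := by rw [sq, hs]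
        have h4 : σ x * (sgn x * P x - 2 * z x) ^ 2 = σ x * P x ^ 2
            - 2 * (σ x * (2 * (sgn x * P x * z x))) + 4 * (σ x * z x ^ 2) := by
          linear_combination (σ x * P x ^ 2) * h3
        linarith
    rw [integral_add' (kPz.neg.add (kPP.const_mul (1 / 2))) (jzz.const_mul 2),
      integral_add' kPz.neg (kPP.const_mul (1 / 2)), integral_neg', z3, integral_const_mul,
      integral_const_mul] at this
    linarith
  refine ⟨∫ x, ρ x * z x ^ 2, integral_nonneg fun x => mul_nonneg (hρ0 x).le (sq_nonneg _),
    ?_, ?_, ?_, ?_⟩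
  · rw [inner_mulL, inner_mulL, ← integral_const_mul, ← integral_add
      ((integrable_mulL _ _ _).const_mul 2) (integrable_mulL _ _ _), ← integral_const_mul,
      ← add_zero (∫ x, 2 * (ρ x * z x ^ 2)), ← mul_zero (1 / 2 : ℝ), ← z1, ← integral_const_mul,
      ← integral_add (jzz.const_mul 2) (jPz.const_mul (1 / 2))]
    refine integral_congr_ae ?_
    filter_upwards [coeFn_expW 1, coeFn_dexpW 1, hae] with x h1 h2 h3
    rw [h1, h2, h3]
    simp only [z, ρ, ← hg]
    ring
  · have e : inner ℝ (mulL (expW 1) (sqH1 u)) (sqH1 u) = ∫ x, ρ x * P x ^ 4 := by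
      rw [inner_mulL]
      refine integral_congr_ae ?_
      filter_upwards [coeFn_expW 1, coeFn_mulL (supL u) (valL u), coeFn_supL u, hae]
        with x h1 h2 h3 h4
      rw [sqH1, h1, h2, h3, h4]
      ring
    rw [e]
    -- By `z2`, ∫ρP⁴ = -4∫ρ sgn P³z ≤ ½∫ρP⁴ + 8∫ρP²z², and P² ≤ M².
    have := integral_mono j4 ((jP3z.add (j4.const_mul (1 / 2))).add (jzz.const_mul (8 * M ^ 2)))
      fun x => by
        simp only [Pi.add_apply]
        have h3 : sgn x ^ 2 = 1 := by rw [sq, hs]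
        have h1 : 0 ≤ ρ x * (P x ^ 2 * (sgn x * P x + 4 * z x) ^ 2) :=
          mul_nonneg (hρ0 x).le (mul_nonneg (sq_nonneg _) (sq_nonneg _))
        have h2 : P x ^ 2 ≤ M ^ 2 := sq_le_sq' (neg_le_of_abs_le (hb x)) (le_of_abs_le (hb x))
        have h5 : ρ x * z x ^ 2 * P x ^ 2 ≤ ρ x * z x ^ 2 * M ^ 2 :=
          mul_le_mul_of_nonneg_left h2 (mul_nonneg (hρ0 x).le (sq_nonneg _))
        have h6 : ρ x * (P x ^ 2 * (sgn x * P x + 4 * z x) ^ 2) = ρ x * P x ^ 4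
            + 8 * (ρ x * (sgn x * P x ^ 3 * z x)) + 16 * (ρ x * z x ^ 2 * P x ^ 2) := by
          linear_combination (ρ x * P x ^ 4) * h3
        linarith
    rw [integral_add' (jP3z.add (j4.const_mul (1 / 2))) (jzz.const_mul (8 * M ^ 2)),
      integral_add' jP3z (j4.const_mul (1 / 2)), z2, integral_const_mul, integral_const_mul] at this
    linarith
  · refine le_trans (le_of_eq ?_) B
    rw [inner_mulL]
    refine integral_congr_ae ?_
    filter_upwards [coeFn_expW 2, hae] with x h1 h2
    rw [h1, h2]
    ring
  · have e : inner ℝ (mulL (expW 2) (dxL u)) (dxL u) = ∫ x, σ x * g x ^ 2 := by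
      rw [inner_mulL]
      refine integral_congr_ae ?_
      filter_upwards [coeFn_expW 2] with x h1
      rw [h1]
      ring
    rw [e]
    -- Since g = z + sgn P/2, one has g² ≤ 2z² + P²/2, and `B` bounds the last term.
    have := integral_mono kgg ((jzz.const_mul 2).add (kPP.const_mul (1 / 2))) fun x => by
      simp only [Pi.add_apply]
      have h1 : σ x * z x ^ 2 ≤ ρ x * z x ^ 2 :=
        mul_le_mul_of_nonneg_right (hσρ x) (sq_nonneg _)
      have h2 : 0 ≤ σ x * (z x - sgn x * P x / 2) ^ 2 := mul_nonneg (hσ0 x).le (sq_nonneg _)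
      have h3 : sgn x ^ 2 = 1 := by rw [sq, hs]
      have h4 : g x = z x + sgn x * P x / 2 := by simp [z]
      have h5 : σ x * (z x - sgn x * P x / 2) ^ 2 + σ x * g x ^ 2 =
          2 * (σ x * z x ^ 2) + 1 / 2 * (σ x * P x ^ 2) := by
        rw [h4]
        linear_combination (σ x * P x ^ 2 / 2) * h3
      linarith
    rw [integral_add' (jzz.const_mul 2) (kPP.const_mul (1 / 2)), integral_const_mul,
      integral_const_mul] at this
    linarith

/-! ### A Barbalat argument -/

theorem monotoneOn_Ici_of_hasDerivWithinAt {f f' : ℝ → ℝ} {a : ℝ}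
    (h : ∀ t, a ≤ t → HasDerivWithinAt f (f' t) (Ici a) t) (h0 : ∀ t, a ≤ t → 0 ≤ f' t) :
    MonotoneOn f (Ici a) := by
  refine monotoneOn_of_hasDerivWithinAt_nonneg (convex_Ici a)
    (fun t ht => (h t ht).continuousWithinAt) (f' := f') (fun t ht => ?_) fun t ht => ?_
  · exact (h t (interior_subset ht)).mono interior_subset
  · exact h0 t (interior_subset ht)

theorem exists_tendsto_of_monotoneOn_Ici {f : ℝ → ℝ} {a K : ℝ} (h : MonotoneOn f (Ici a))
    (hK : ∀ t, a ≤ t → f t ≤ K) : ∃ l, Tendsto f atTop (𝓝 l) := by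
  have hm : Monotone fun t => f (max t a) := fun s t hst =>
    h (mem_Ici.2 (le_max_right _ _)) (mem_Ici.2 (le_max_right _ _)) (max_le_max_right a hst)
  have hb : BddAbove (range fun t => f (max t a)) :=
    ⟨K, by rintro _ ⟨t, rfl⟩; exact hK _ (le_max_right _ _)⟩
  refine ⟨_, (tendsto_atTop_ciSup hm hb).congr' ?_⟩
  filter_upwards [eventually_ge_atTop a] with t ht
  rw [max_eq_left ht]

/-- A variant of Barbalat's lemma: a nonnegative Lipschitz function that is dominated by the
derivative of a bounded function tends to zero. -/
theorem tendsto_zero_of_le_deriv {f f' Φ Φ' : ℝ → ℝ} {L K : ℝ} (h0 : ∀ t, 0 ≤ t → 0 ≤ f t)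
    (hf : ∀ t, 0 ≤ t → HasDerivWithinAt f (f' t) (Ici 0) t) (hL : ∀ t, 0 ≤ t → |f' t| ≤ L)
    (hΦ : ∀ t, 0 ≤ t → HasDerivWithinAt Φ (Φ' t) (Ici 0) t) (hle : ∀ t, 0 ≤ t → f t ≤ Φ' t)
    (hK : ∀ t, 0 ≤ t → Φ t ≤ K) : Tendsto f atTop (𝓝 0) := by
  have hL0 : 0 ≤ L := (abs_nonneg _).trans (hL 0 le_rfl)
  obtain ⟨l, hl⟩ := exists_tendsto_of_monotoneOn_Ici
    (monotoneOn_Ici_of_hasDerivWithinAt hΦ fun t ht => (h0 t ht).trans (hle t ht)) hK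
  -- The function 2LΦ - f² is nondecreasing, as its derivative is at least 2Lf - 2f|f'| ≥ 0. Being
  -- bounded above it converges, hence so does f².
  obtain ⟨m, hm⟩ := exists_tendsto_of_monotoneOn_Ici (K := 2 * L * K)
    (f := fun t => 2 * L * Φ t - f t * f t)
    (monotoneOn_Ici_of_hasDerivWithinAt
      (fun t ht => ((hΦ t ht).const_mul (2 * L)).sub ((hf t ht).mul (hf t ht))) fun t ht => by
        have h1 := mul_le_mul_of_nonneg_left (hle t ht) hL0
        have h2 := mul_le_mul_of_nonneg_left ((le_abs_self _).trans (hL t ht)) (h0 t ht)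
        nlinarith)
    (fun t ht => by nlinarith [mul_le_mul_of_nonneg_left (hK t ht) hL0, mul_self_nonneg (f t)])
  have hsq : Tendsto (fun t => f t * f t) atTop (𝓝 (2 * L * l - m)) :=
    ((hl.const_mul (2 * L)).sub hm).congr fun t => by ring
  have hlim : Tendsto f atTop (𝓝 (√(2 * L * l - m))) := by
    refine ((Real.continuous_sqrt.tendsto _).comp hsq).congr' ?_
    filter_upwards [eventually_ge_atTop 0] with t ht
    exact Real.sqrt_mul_self (h0 t ht)
  set k := √(2 * L * l - m)
  rcases (Real.sqrt_nonneg (2 * L * l - m)).eq_or_lt with hk | hk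
  · rwa [show k = 0 from hk.symm] at hlim
  exfalso
  change 0 < k at hk
  -- A positive limit `k` would give Φ' ≥ f > k/2 eventually, so Φ would exceed `K` in finite time.
  obtain ⟨T, hT⟩ := eventually_atTop.1 (hlim.eventually (lt_mem_nhds (half_lt_self hk)))
  set T' := max T 0
  have hT0 : 0 ≤ T' := le_max_right _ _
  have hmono := monotoneOn_Ici_of_hasDerivWithinAt (a := T') (f := fun t => Φ t - k / 2 * t)
    (fun t ht => ((hΦ t (hT0.trans ht)).mono (Ici_subset_Ici.2 hT0)).sub
      ((hasDerivWithinAt_id t _).const_mul (k / 2))) fun t ht => by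
        have := hle t (hT0.trans ht)
        have := hT t ((le_max_left _ _).trans ht)
        linarith
  have hs : 0 ≤ 2 / k * (K - Φ T' + 1) := by
    have := hK T' hT0
    have : 0 ≤ K - Φ T' + 1 := by linarith
    positivity
  have h1 := hmono self_mem_Ici (mem_Ici.2 (le_add_of_nonneg_right hs)) (le_add_of_nonneg_right hs)
  have h2 := hK (T' + 2 / k * (K - Φ T' + 1)) (by linarith)
  have h3 : k / 2 * (2 / k * (K - Φ T' + 1)) = K - Φ T' + 1 := by field_simp
  simp only at h1
  nlinarith

/-! ### Weighted estimates -/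

theorem abs_inner_mulL_le (a : Lp ℝ ⊤ (volume : Measure ℝ)) (f g : L2R) :
    |inner ℝ (mulL a f) g| ≤ ‖a‖ * ‖f‖ * ‖g‖ :=
  (abs_real_inner_le_norm _ _).trans
    (mul_le_mul_of_nonneg_right (norm_mulL_le a f) (norm_nonneg g))

theorem inner_expW_nonneg (k : ℕ) (f : L2R) : 0 ≤ inner ℝ (mulL (expW k) f) f := by
  rw [inner_mulL]
  refine integral_nonneg_of_ae ?_
  filter_upwards [coeFn_expW k] with x hx
  rw [hx, mul_assoc]
  exact mul_nonneg (Real.exp_pos _).le (mul_self_nonneg _)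

theorem inner_expW_two_le (f : L2R) :
    inner ℝ (mulL (expW 2) f) f ≤ inner ℝ (mulL (expW 1) f) f := by
  rw [inner_mulL, inner_mulL]
  refine integral_mono_ae (integrable_mulL _ _ _) (integrable_mulL _ _ _) ?_
  filter_upwards [coeFn_expW 1, coeFn_expW 2] with x h1 h2
  rw [h1, h2, mul_assoc, mul_assoc]
  refine mul_le_mul_of_nonneg_right (Real.exp_le_exp.2 ?_) (mul_self_nonneg _)
  push_cast
  linarith [abs_nonneg x]

/-- Expansion of the nonnegative weighted form at f ± c g. -/
theorem abs_two_mul_inner_expW_le (k : ℕ) (c : ℝ) (f g : L2R) :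
    |2 * c * inner ℝ (mulL (expW k) f) g| ≤
      inner ℝ (mulL (expW k) f) f + c ^ 2 * inner ℝ (mulL (expW k) g) g := by
  have h1 := inner_expW_nonneg k (f - c • g)
  have h2 := inner_expW_nonneg k (f + c • g)
  simp only [map_sub, map_add, map_smul, inner_sub_left, inner_sub_right, inner_add_left,
    inner_add_right, inner_smul_left, inner_smul_right, inner_mulL_comm _ g f,
    RCLike.conj_to_real] at h1 h2
  rw [abs_le]
  constructor <;> nlinarith

theorem abs_inner_dexpW_two_le (f g : L2R) :
    |inner ℝ (mulL (dexpW 2) f) g| ≤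
      inner ℝ (mulL (expW 2) f) f + inner ℝ (mulL (expW 2) g) g := by
  rw [inner_mulL, inner_mulL, inner_mulL,
    ← integral_add (integrable_mulL _ _ _) (integrable_mulL _ _ _)]
  refine abs_integral_le_integral_abs.trans (integral_mono_ae (integrable_mulL _ _ _).abs
    ((integrable_mulL _ _ _).add (integrable_mulL _ _ _)) ?_)
  filter_upwards [coeFn_expW 2, coeFn_dexpW 2] with x h1 h2
  rw [h1, h2]
  simp only [abs_mul, abs_neg, abs_sgn, Nat.cast_ofNat, abs_two, Real.abs_exp]
  have := Real.exp_pos (-(2 * |x|))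
  have h3 : f x * f x + g x * g x - 2 * (|f x| * |g x|) = (|f x| - |g x|) ^ 2 := by
    rw [sub_sq, sq_abs, sq_abs]
    ring
  nlinarith [mul_nonneg this.le (sq_nonneg (|f x| - |g x|))]

/-- Turns the cubic terms into pairings of u² with n, to which Young's inequality applies. -/
theorem inner_mulL_mulL_supL (a : Lp ℝ ⊤ (volume : Measure ℝ)) (u : H1R) (f : L2R) :
    inner ℝ (mulL a (valL u)) (mulL (supL u) f) = inner ℝ (mulL a (sqH1 u)) f := by
  rw [inner_mulL_right, inner_mulL, inner_mulL]
  refine integral_congr_ae ?_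
  filter_upwards [coeFn_mulL a (valL u), coeFn_mulL (supL u) (valL u)] with x h1 h2
  rw [sqH1, h1, h2]
  ring

theorem exp_mul_integral_Icc_le (a b : ℝ) (f : L2R) :
    Real.exp (-(2 * (|a| + |b|))) * ∫ x in Icc a b, f x ^ 2 ≤ inner ℝ (mulL (expW 2) f) f := by
  have hf : Integrable fun x => f x ^ 2 := by simpa only [sq] using L2R.integrable_mul f f
  have hi := integrable_mulL (expW 2) f f
  have hnn : 0 ≤ᵐ[volume] fun x => expW 2 x * f x * f x := by
    filter_upwards [coeFn_expW 2] with x hx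
    rw [hx, mul_assoc]
    exact mul_nonneg (Real.exp_pos _).le (mul_self_nonneg _)
  rw [← integral_const_mul, inner_mulL]
  refine le_trans ?_ (setIntegral_le_integral (s := Icc a b) hi hnn)
  refine setIntegral_mono_on_ae (hf.const_mul _).integrableOn hi.integrableOn measurableSet_Icc ?_
  filter_upwards [coeFn_expW 2] with x hx hxI
  rw [hx, mul_assoc, ← sq]
  refine mul_le_mul_of_nonneg_right (Real.exp_le_exp.2 ?_) (sq_nonneg _)
  have : |x| ≤ |a| + |b| := abs_le.2
    ⟨by linarith [neg_abs_le a, abs_nonneg b, hxI.1], by linarith [le_abs_self b, abs_nonneg a, hxI.2]⟩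
  push_cast
  linarith

/-! ### Decay of the localized energy -/

/-- The energy localized by the weight `e^{-2|x|}`. -/
def localEnergy (u : H1R) (w n v : L2R) : ℝ :=
  inner ℝ (mulL (expW 2) (valL u)) (valL u)
    + inner ℝ (mulL (expW 2) (dxL u)) (dxL u) + inner ℝ (mulL (expW 2) w) w
    + (1 / 2) * inner ℝ (mulL (expW 2) n) n + (1 / 2) * inner ℝ (mulL (expW 2) v) v

theorem norm_sqH1_le (u : H1R) : ‖sqH1 u‖ ≤ ‖u‖ ^ 2 := by
  refine (norm_mulL_le _ _).trans ?_
  rw [sq]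
  exact mul_le_mul (norm_supL_le u) (H1R.norm_valL_le u) (norm_nonneg _) (norm_nonneg _)

namespace IsKGZCurve

variable {u : ℝ → H1R} {w n v : ℝ → L2R}

/-- Conservation of the energy bounds all components of a solution with `u` small. -/
theorem exists_bound (H : IsKGZCurve u w n v) (hu : ∀ t, 0 ≤ t → ‖u t‖ ≤ 1 / 4) :
    ∃ B : ℝ, 0 ≤ B ∧ ∀ t, 0 ≤ t → ‖w t‖ ≤ B ∧ ‖n t‖ ≤ B ∧ ‖v t‖ ≤ B := by
  let E : ℝ → ℝ := fun s => ‖u s‖ ^ 2 + ‖w s‖ ^ 2 + (1 / 2) * ‖n s‖ ^ 2 + (1 / 2) * ‖v s‖ ^ 2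
      + inner ℝ (n s) (sqH1 (u s))
  have hE : ∀ t, 0 ≤ t → E t = E 0 := fun t ht =>
    constant_of_has_deriv_right_zero (f := E) (a := 0) (b := t)
      (fun s hs => (H.hasDeriv_energy hs.1).continuousWithinAt.mono Icc_subset_Ici_self)
      (fun s hs => (H.hasDeriv_energy hs.1).mono (Ici_subset_Ici.2 hs.1)) t ⟨ht, le_rfl⟩
  -- The cubic term of the energy is at most ‖n‖ ≤ ¼‖n‖² + 1, half of the quadratic term in n plus a
  -- constant.
  have key : ∀ t, 0 ≤ t → ‖w t‖ ^ 2 + (1 / 4) * ‖n t‖ ^ 2 + (1 / 4) * ‖v t‖ ^ 2 ≤ E 0 + 1 := by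
    intro t ht
    have h1 := hE t ht
    have h2 := abs_le.1 (abs_real_inner_le_norm (n t) (sqH1 (u t)))
    have h3 : ‖sqH1 (u t)‖ ≤ 1 := by
      refine (norm_sqH1_le _).trans ?_
      nlinarith [hu t ht, norm_nonneg (u t)]
    have h4 : ‖n t‖ * ‖sqH1 (u t)‖ ≤ ‖n t‖ := mul_le_of_le_one_right (norm_nonneg _) h3
    simp only [E] at h1 ⊢
    nlinarith [sq_nonneg ‖u t‖, sq_nonneg ‖v t‖, sq_nonneg (‖n t‖ - 2)]
  have hE0 : 0 ≤ E 0 + 1 := le_trans (by positivity) (key 0 le_rfl)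
  refine ⟨4 * (E 0 + 1) + 1, by linarith, fun t ht => ?_⟩
  have h := key t ht
  refine ⟨?_, ?_, ?_⟩ <;>
    nlinarith [sq_nonneg ‖w t‖, sq_nonneg ‖n t‖, sq_nonneg ‖v t‖, sq_nonneg (‖w t‖ - 1),
      sq_nonneg (‖n t‖ - 1), sq_nonneg (‖v t‖ - 1)]

theorem tendsto_localEnergy (H : IsKGZCurve u w n v)
    (hodd : ∀ t, 0 ≤ t → IsOddL2 (valL (u t))) (hu : ∀ t, 0 ≤ t → ‖u t‖ ≤ 1 / 4) :
    Tendsto (fun t => localEnergy (u t) (w t) (n t) (v t)) atTop (𝓝 0) := by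
  obtain ⟨B, hB0, hB⟩ := H.exists_bound hu
  have hU : ∀ t, 0 ≤ t → ‖valL (u t)‖ ≤ 1 := fun t ht =>
    (H1R.norm_valL_le _).trans ((hu t ht).trans (by norm_num))
  have hP : ∀ t, 0 ≤ t → ‖dxL (u t)‖ ≤ 1 := fun t ht =>
    (H1R.norm_dxL_le _).trans ((hu t ht).trans (by norm_num))
  have hS : ∀ t, 0 ≤ t → ‖supL (u t)‖ ≤ 1 := fun t ht =>
    (norm_supL_le _).trans ((hu t ht).trans (by norm_num))
  have hbd : ∀ (a : Lp ℝ ⊤ (volume : Measure ℝ)) {f g : L2R} {x y : ℝ}, 0 ≤ x → ‖f‖ ≤ x → ‖g‖ ≤ y →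
      |inner ℝ (mulL a f) g| ≤ ‖a‖ * x * y := fun a f g x y hx hf hg =>
    (abs_inner_mulL_le a f g).trans
      (mul_le_mul (mul_le_mul_of_nonneg_left hf (norm_nonneg a)) hg (norm_nonneg _) (by positivity))
  have hF : ∀ t, 0 ≤ t → ‖mulL (supL (u t)) (n t)‖ ≤ B := fun t ht =>
    (norm_mulL_le _ _).trans ((mul_le_of_le_one_left (norm_nonneg _) (hS t ht)).trans (hB t ht).2.1)
  have hG : ∀ t, 0 ≤ t → ‖sqDx (u t)‖ ≤ 2 := fun t ht => by
    rw [sqDx, norm_smul, Real.norm_two]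
    have := (norm_mulL_le (supL (u t)) (dxL (u t))).trans
      (mul_le_mul (hS t ht) (hP t ht) (norm_nonneg _) zero_le_one)
    linarith
  -- Here Φ = ∫e^{-2|x|} u u_t - 25 V. The first term produces u_t² and errors of size at most a
  -- multiple of the virial quantities. With the terms of the localized energy moved across, the
  -- total cost in W is 8 + 8 + 8 + ½ = 24.5, whence 25.
  refine tendsto_zero_of_le_deriv (h0 := fun t _ => ?_)
    (hf := fun t ht => H.hasDeriv_weightedEnergy (hasWeightDeriv_expW 2) ht)
    (L := 2 * (‖dexpW 2‖ * 1 * B) + 2 * (‖expW 2‖ * B * B) + ‖dexpW 2‖ * B * B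
      + ‖expW 2‖ * B * 2) (hL := fun t ht => ?_)
    (hΦ := fun t ht => (H.hasDeriv_inner_val_w (hasWeightDeriv_expW 2) ht).sub
      ((H.hasDeriv_virial hasWeightDeriv_phiW (hasWeightDeriv_expW 1) ht).const_mul 25))
    (hle := fun t ht => ?_)
    (K := ‖expW 2‖ * 1 * B
      + 25 * (2 * (‖phiW‖ * 1 * B) + ‖expW 1‖ * 1 * B + ‖phiW‖ * B * B)) (hK := fun t ht => ?_)
  · have := inner_expW_nonneg 2
    have h1 := this (valL (u t))
    have h2 := this (dxL (u t))
    have h3 := this (w t)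
    have h4 := this (n t)
    have h5 := this (v t)
    unfold localEnergy
    positivity
  · obtain ⟨hw, hn, hv⟩ := hB t ht
    have h1 := abs_le.1 (hbd (dexpW 2) zero_le_one (hP t ht) hw)
    have h2 := abs_le.1 (hbd (expW 2) hB0 hw (hF t ht))
    have h3 := abs_le.1 (hbd (dexpW 2) hB0 hn hv)
    have h4 := abs_le.1 (hbd (expW 2) hB0 hv (hG t ht))
    rw [abs_le]
    constructor <;> linarith
  · obtain ⟨W, hW0, hW1, hW2, hW3, hW4⟩ := (hodd t ht).exists_coercive
    have hsq : inner ℝ (mulL (expW 1) (sqH1 (u t))) (sqH1 (u t)) ≤ W := by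
      refine hW2.trans (mul_le_of_le_one_left hW0 ?_)
      nlinarith [hu t ht, norm_nonneg (u t)]
    -- With c = 1/2 the cubic virial term costs W + ¼∫e^{-|x|}n², out of the available 2W +
    -- ½∫e^{-|x|}n².
    have h1 := abs_le.1 (abs_two_mul_inner_expW_le 1 (1 / 2) (sqH1 (u t)) (n t))
    have h2 := abs_le.1 (abs_two_mul_inner_expW_le 2 1 (sqH1 (u t)) (n t))
    have h3 := abs_le.1 (abs_inner_dexpW_two_le (valL (u t)) (dxL (u t)))
    have h4 := inner_expW_two_le (sqH1 (u t))
    have h5 := inner_expW_two_le (n t)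
    have h6 := inner_expW_two_le (v t)
    have h7 := inner_expW_nonneg 1 (n t)
    have h8 := inner_expW_nonneg 1 (v t)
    rw [inner_mulL_mulL_supL, inner_mulL_mulL_supL, localEnergy]
    linarith
  · obtain ⟨hw, hn, hv⟩ := hB t ht
    have h1 := abs_le.1 (hbd (expW 2) zero_le_one (hU t ht) hw)
    have h2 := abs_le.1 (hbd phiW zero_le_one (hP t ht) hw)
    have h3 := abs_le.1 (hbd (expW 1) zero_le_one (hU t ht) hw)
    have h4 := abs_le.1 (hbd phiW hB0 hn hv)
    simp only [Pi.sub_apply]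
    linarith

end IsKGZCurve

/-! ### Local norms and conclusion -/

/-- The local norms are controlled by the localized energy. -/
theorem localNorm_le (a b : ℝ) (u : H1R) (w n v : L2R) :
    normH1On a b u + normL2On a b w + normL2On a b n + normL2On a b v ≤
      4 * √(2 * Real.exp (2 * (|a| + |b|)) * localEnergy u w n v) := by
  have hpos := Real.exp_pos (-(2 * (|a| + |b|)))
  have hexp : Real.exp (2 * (|a| + |b|)) * Real.exp (-(2 * (|a| + |b|))) = 1 := by
    rw [← Real.exp_add]
    simp
  have hpos' := Real.exp_pos (2 * (|a| + |b|))
  have n1 := inner_expW_nonneg 2 (valL u)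
  have n2 := inner_expW_nonneg 2 (dxL u)
  have n3 := inner_expW_nonneg 2 w
  have n4 := inner_expW_nonneg 2 n
  have n5 := inner_expW_nonneg 2 v
  have key : ∀ f : L2R, ∫ x in Icc a b, f x ^ 2 ≤
      Real.exp (2 * (|a| + |b|)) * inner ℝ (mulL (expW 2) f) f := fun f => by
    have := mul_le_mul_of_nonneg_left (exp_mul_integral_Icc_le a b f) hpos'.le
    rwa [← mul_assoc, hexp, one_mul] at this
  -- The factor 2 compensates the weights ½ of n and v in the localized energy.
  have hle : ∀ {x : ℝ}, x ≤ 2 * localEnergy u w n v →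
      √(Real.exp (2 * (|a| + |b|)) * x) ≤
        √(2 * Real.exp (2 * (|a| + |b|)) * localEnergy u w n v) := fun hx =>
    Real.sqrt_le_sqrt (by nlinarith)
  have hsq : ∀ f : L2R, Integrable fun x => f x ^ 2 := fun f => by
    simpa only [sq] using L2R.integrable_mul f f
  have h1 : normH1On a b u ≤ √(2 * Real.exp (2 * (|a| + |b|)) * localEnergy u w n v) := by
    refine le_trans (Real.sqrt_le_sqrt ?_) (hle (x := inner ℝ (mulL (expW 2) (valL u)) (valL u)
      + inner ℝ (mulL (expW 2) (dxL u)) (dxL u)) ?_)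
    · change ∫ x in Icc a b, (valL u x ^ 2 + dxL u x ^ 2) ≤ _
      rw [integral_add (hsq _).integrableOn (hsq _).integrableOn, mul_add]
      exact add_le_add (key _) (key _)
    · unfold localEnergy
      linarith
  have h2 : normL2On a b w ≤ √(2 * Real.exp (2 * (|a| + |b|)) * localEnergy u w n v) :=
    (Real.sqrt_le_sqrt (key w)).trans (hle (by unfold localEnergy; linarith))
  have h3 : normL2On a b n ≤ √(2 * Real.exp (2 * (|a| + |b|)) * localEnergy u w n v) :=
    (Real.sqrt_le_sqrt (key n)).trans (hle (by unfold localEnergy; linarith))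
  have h4 : normL2On a b v ≤ √(2 * Real.exp (2 * (|a| + |b|)) * localEnergy u w n v) :=
    (Real.sqrt_le_sqrt (key v)).trans (hle (by unfold localEnergy; linarith))
  linarith


end

theorem theorem3 :
    ∃ ε : ℝ, 0 < ε ∧
      ∀ (u : ℝ → H1R) (w n v : ℝ → L2R),
        IsKGZSolution u w n v →
        (∀ t : ℝ, 0 ≤ t → IsOddL2 (l2Val (u t))) →
        (∀ t : ℝ, 0 ≤ t → ‖u t‖ ≤ ε) →
        (∃ C : ℝ, ∀ t : ℝ, 0 ≤ t → ‖w t‖ ≤ C) →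
        ∀ a b : ℝ,
          Tendsto
            (fun t : ℝ =>
              normH1On a b (u t) + normL2On a b (w t) + normL2On a b (n t) + normL2On a b (v t))
            atTop (𝓝 0) := by
  -- The value 1/4 makes the factor 16‖u‖² in the quartic estimate at most 1.
  refine ⟨1 / 4, by norm_num, fun u w n v h hodd hu _ a b => ?_⟩
  have hlim := h.isKGZCurve.tendsto_localEnergy (fun t ht => hodd _ (le_max_right t 0))
    (fun t ht => hu _ (le_max_right t 0))
  have hlim' : Tendsto (fun t => localEnergy (u t) (w t) (n t) (v t)) atTop (𝓝 0) := by
    refine hlim.congr' ?_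
    filter_upwards [eventually_ge_atTop 0] with t ht
    rw [max_eq_left ht]
  refine squeeze_zero (fun t => ?_) (fun t => localNorm_le a b (u t) (w t) (n t) (v t)) ?_
  · exact add_nonneg (add_nonneg (add_nonneg (Real.sqrt_nonneg _) (Real.sqrt_nonneg _))
      (Real.sqrt_nonneg _)) (Real.sqrt_nonneg _)
  · have := ((hlim'.const_mul (2 * Real.exp (2 * (|a| + |b|)))).sqrt).const_mul 4
    simpa using this
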